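/- Let $n\ge 0$ be an integer and $q>0$ a real number. A half-diagram on $n$ points is a partition of $\{1,\dots,n\}$ into sets of one element (points with a through-string) or two elements (arches) which is noncrossing: there are no arches $\{i,j\}$, $\{k,l\}$ with $i<k<j<l$, and no arch $\{i,j\}$ and through-string point $k$ with $i<k<j$. Let $U(n)$ be the complex vector space with basis $\{\xi_{\mathfrak a}\}$ indexed by the half-diagrams on $n$ points, with the sesquilinear form determined as follows. Identify the points of $\mathfrak a$ with those of $\mathfrak b$. If some path connects two different through-strings of the same half-diagram, then $\langle\xi_{\mathfrak a},\xi_{\mathfrak b}\rangle=0$; otherwise $\langle\xi_{\mathfrak a},\xi_{\mathfrak b}\rangle=q^{c}$, where $c$ is the number of closed loops. The Temperley-Lieb algebra $TL_n(q)$ acts on $U(n)$ by concatenation of diagrams: each closed loop contributes a factor $q$, and the result is $0$ if two through-strings of the half-diagram become connected. Let $e_1,\dots,e_{n-1}$ be the standard diagrammatic generators. The $k$-th bracket of $\mathfrak a$ is opening if $k$ has a through-string or is joined to a larger point, and closing otherwise. Let $h_i(\mathfrak a)$ be the number of opening minus the number of closing brackets among the first $i$ brackets. A half-diagram is uniquely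 determined by its sequence of brackets. It has a minimum at $i$ ($1\le i<n$) if its $i$-th bracket is closing and its $(i+1)$-th is opening; then $\Diamond_i(\mathfrak a)$ is the half-diagram obtained by making the $i$-th bracket opening and the $(i+1)$-th closing. The minimal half-diagram with $p$ arches is the one with arches $\{1,2\},\{3,4\},\dots,\{2p-1,2p\}$; equivalently, the height just before every closing bracket is $1$. Let $\Delta_k=\Delta_k(q)$ be the Chebyshev polynomials with $\Delta_{-1}=0$, $\Delta_0=1$, $\Delta_{k+1}=q\Delta_k-\Delta_{k-1}$, and let $\mu_k=\Delta_{k-1}/\Delta_k$. Define vectors $\xi'_{\mathfrak a}$ by $\xi'_{\mathfrak a}=\xi_{\mathfrak a}$ if $\mathfrak a$ is minimal, and $$\xi'_{\Diamond_i(\mathfrak a)}=\bigl(e_i-\mu_{h_i(\mathfrak a)+1}\bigr)\,\xi'_{\mathfrak a}\qquad\text{if }\mathfrak a\text{ has a minimum at }i .$$ Call $p$ admissible if $\Delta_{h_i(\mathfrak c)+1}(q)\ne 0$ for every half-diagram $\mathfrak c$ on $n$ points with $p$ arches and every minimum $i$ of $\mathfrak c$, i.e. if all the quotients $\mu$ occurring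 in this definition for half-diagrams with $p$ arches are well-defined. **Theorem.** (1) If the number of arches of $\mathfrak a$ is admissible, then $\xi'_{\mathfrak a}$ is well-defined: $\mathfrak a$ can be reached from a minimal half-diagram by box additions $\Diamond_i$, and the resulting vector does not depend on the sequence of box additions. (2) If $\mathfrak a\ne\mathfrak b$ are half-diagrams on $n$ points whose numbers of arches are both admissible, then $\langle\xi'_{\mathfrak a},\xi'_{\mathfrak b}\rangle=0$, whether or not $\mathfrak a$ and $\mathfrak b$ have the same number of through-strings. -/

import Mathlib

/-- A (noncrossing) half-diagram on `n` points: a partition of the points into sets of one or two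
elements, given by the involution `partner`. A fixed point of `partner` carries a through-string;
two points exchanged by `partner` are joined by an arch. Point `k : Fin n` is the `(k+1)`-th point. -/
@[ext]
structure HalfDiagram (n : ℕ) where
  partner : Fin n → Fin n
  partner_partner : ∀ i, partner (partner i) = i
  /-- two arches do not cross -/
  arch_arch : ∀ i k, ¬ (i < k ∧ k < partner i ∧ partner i < partner k)
  /-- no through-string lies below an arch -/
  arch_through : ∀ i k, ¬ (i < k ∧ k < partner i ∧ partner k = k)

/-- The numbering of the `2n` points of a diagram in `TL_n` by `1, …, 2n`: `Sum.inl k` is the point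
number `k + 1`, on the left side, and `Sum.inr k` is the point opposite to it on the right side,
which has the number `2n - k`. -/
def tlNumber (n : ℕ) : Fin n ⊕ Fin n → ℕ
  | Sum.inl k => k.val + 1
  | Sum.inr k => 2 * n - k.val

/-- A (noncrossing) pairing of `2n` points, a basis diagram of the Temperley-Lieb algebra `TL_n`. -/
@[ext]
structure TLDiagram (n : ℕ) where
  partner : Fin n ⊕ Fin n → Fin n ⊕ Fin n
  partner_partner : ∀ x, partner (partner x) = x
  partner_ne : ∀ x, partner x ≠ x
  noncrossing : ∀ x y, ¬ (tlNumber n x < tlNumber n y ∧ tlNumber n y < tlNumber n (partner x) ∧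
    tlNumber n (partner x) < tlNumber n (partner y))

/-- The diagram of the generator `e_{i+1}`, which joins the points `i + 1` and `i + 2` on the
left to each other, likewise the points opposite to them on the right, and joins every other point to the point
opposite to it. -/
def tlGen {n : ℕ} (i : ℕ) (hi : i + 1 < n) : TLDiagram n where
  partner
    | Sum.inl k => if k.val = i then Sum.inl ⟨i + 1, hi⟩
        else if k.val = i + 1 then Sum.inl ⟨i, by omega⟩ else Sum.inr k
    | Sum.inr k => if k.val = i then Sum.inr ⟨i + 1, hi⟩
        else if k.val = i + 1 then Sum.inr ⟨i, by omega⟩ else Sum.inl k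
  partner_partner := by
    rintro (⟨k, hk⟩ | ⟨k, hk⟩) <;> dsimp only <;> split_ifs <;> simp_all
  partner_ne := by
    rintro (⟨k, hk⟩ | ⟨k, hk⟩) <;> dsimp only <;> split_ifs <;> simp_all
  noncrossing := by
    rintro (⟨k, hk⟩ | ⟨k, hk⟩) (⟨l, hl⟩ | ⟨l, hl⟩) <;> dsimp only <;> split_ifs <;>
      simp only [tlNumber] <;> omega

/-- The space `U(n)` of formal complex linear combinations of half-diagrams on `n` points. The basis
element belonging to the half-diagram `a` is `Finsupp.single a 1`. -/
abbrev HalfSpace (n : ℕ) : Type := HalfDiagram n →₀ ℂ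

/-! ### Concatenations -/

/-- The concatenation of a diagram `p` with a half-diagram `a`: the graph on the `2n` points of `p`
in which, besides the edges of `p`, the right points `Sum.inr k` are identified with the points `k`
of `a` and joined by the arches of `a`. -/
def concatGraph {n : ℕ} (p : TLDiagram n) (a : HalfDiagram n) : SimpleGraph (Fin n ⊕ Fin n) :=
  SimpleGraph.fromRel fun x y => p.partner x = y ∨
    ∃ k : Fin n, x = Sum.inr k ∧ y = Sum.inr (a.partner k)

/-- Some path in the concatenation connects two different through-strings of `a`. -/
def ConcatVanishes {n : ℕ} (p : TLDiagram n) (a : HalfDiagram n) : Prop :=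
  ∃ i j : Fin n, i ≠ j ∧ a.partner i = i ∧ a.partner j = j ∧
    (concatGraph p a).Reachable (Sum.inr i) (Sum.inr j)

/-- The number of closed loops of the concatenation. Every vertex has two edges, apart from the left
points (one edge in the graph) and the points at which `a` has a through-string (where the second
edge goes to infinity), so the closed loops are the components that contain neither. -/
noncomputable def concatLoops {n : ℕ} (p : TLDiagram n) (a : HalfDiagram n) : ℕ :=
  Nat.card {C : (concatGraph p a).ConnectedComponent //
    ∀ k : Fin n, Sum.inl k ∉ C.supp ∧ (a.partner k = k → Sum.inr k ∉ C.supp)}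

/-- `b` is the half-diagram left on the left points of the concatenation after the identified points
and the closed loops have been deleted: two different points are joined by an arch of `b` exactly if
a path of the concatenation connects them. -/
def IsConcat {n : ℕ} (p : TLDiagram n) (a b : HalfDiagram n) : Prop :=
  ∀ i j : Fin n, i ≠ j →
    (b.partner i = j ↔ (concatGraph p a).Reachable (Sum.inl i) (Sum.inl j))

/-- There is at most one half-diagram left by a concatenation. -/
theorem IsConcat.unique {n : ℕ} {p : TLDiagram n} {a b c : HalfDiagram n}
    (hb : IsConcat p a b) (hc : IsConcat p a c) : b = c := by
  ext i
  congr 1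
  by_cases h : b.partner i = i
  · by_cases h' : c.partner i = i
    · rw [h, h']
    · have := (hb i (c.partner i) (Ne.symm h')).2 ((hc i (c.partner i) (Ne.symm h')).1 rfl)
      exact this
  · exact ((hc i (b.partner i) (Ne.symm h)).2 ((hb i (b.partner i) (Ne.symm h)).1 rfl)).symm

open Classical in
/-- The action of the basis element of `TL_n(q)` belonging to the diagram `p` on the basis element
belonging to `a`: it is `0` if two through-strings of `a` become connected, and otherwise `q ^ c`
times the basis element of the half-diagram `b` left by the concatenation, where `c` is the number
of closed loops. -/
noncomputable def tlActBasis {n : ℕ} (q : ℝ) (p : TLDiagram n) (a : HalfDiagram n) : HalfSpace n :=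
  if h : ¬ ConcatVanishes p a ∧ ∃ b, IsConcat p a b then
    Finsupp.single h.2.choose ((q : ℂ) ^ concatLoops p a)
  else 0

/-- The linear extension of this action to `U(n)`. -/
noncomputable def tlAct {n : ℕ} (q : ℝ) (p : TLDiagram n) : HalfSpace n →ₗ[ℂ] HalfSpace n :=
  Finsupp.linearCombination ℂ (tlActBasis q p)

/-! ### The sesquilinear form -/

/-- The graph obtained from two half-diagrams by identifying their points. -/
def glueGraph {n : ℕ} (a b : HalfDiagram n) : SimpleGraph (Fin n) :=
  SimpleGraph.fromRel fun i j => a.partner i = j ∨ b.partner i = j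

/-- Some path connects two different through-strings of the same half-diagram. -/
def GlueVanishes {n : ℕ} (a b : HalfDiagram n) : Prop :=
  ∃ i j : Fin n, i ≠ j ∧ (glueGraph a b).Reachable i j ∧
    ((a.partner i = i ∧ a.partner j = j) ∨ (b.partner i = i ∧ b.partner j = j))

/-- The number of closed loops: the components without a through-string of `a` or `b`. -/
noncomputable def glueLoops {n : ℕ} (a b : HalfDiagram n) : ℕ :=
  Nat.card {C : (glueGraph a b).ConnectedComponent //
    ∀ k ∈ C.supp, a.partner k ≠ k ∧ b.partner k ≠ k}

open Classical in
/-- The value of the form on two basis elements. -/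
noncomputable def halfFormBasis {n : ℕ} (q : ℝ) (a b : HalfDiagram n) : ℝ :=
  if GlueVanishes a b then 0 else q ^ glueLoops a b

/-- The diagrammatic sesquilinear form on `U(n)`, linear in the first and conjugate linear in the
second argument. -/
noncomputable def halfForm {n : ℕ} (q : ℝ) (u v : HalfSpace n) : ℂ :=
  u.sum fun a x => v.sum fun b y => x * (starRingEnd ℂ) y * (halfFormBasis q a b : ℂ)

/-! ### Dyck paths and box addition -/

namespace HalfDiagram

variable {n : ℕ}

/-- The bracket at `k` is an opening bracket (an upward step of the Dyck path): `k` has a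
through-string or is joined to a later point. Otherwise it is a closing bracket (a downward step). -/
def IsOpening (a : HalfDiagram n) (k : Fin n) : Prop := k ≤ a.partner k

instance (a : HalfDiagram n) (k : Fin n) : Decidable (a.IsOpening k) :=
  inferInstanceAs (Decidable (k ≤ a.partner k))

/-- The height `h_m(a)` of the Dyck path after `m` steps: the number of opening brackets minus the
number of closing brackets among the first `m` brackets. -/
def height (a : HalfDiagram n) (m : ℕ) : ℤ :=
  ∑ k : Fin n, if k.val < m then (if a.IsOpening k then 1 else -1) else 0

/-- The number `p` of arches; there are `n - 2p` through-strings. -/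
def numPairs (a : HalfDiagram n) : ℕ := (Finset.univ.filter fun k : Fin n => k < a.partner k).card

/-- The minimal diagram with its number of arches, whose restricted sequence is `(1, …, 1)`: the
height just before each closing bracket is `1`. -/
def IsMinimal (a : HalfDiagram n) : Prop := ∀ k : Fin n, ¬ a.IsOpening k → a.height k.val = 1

/-- The Dyck path of `a` has a minimum at the position `i + 1`: a downward step
followed by an upward step. -/
def HasMinimum (a : HalfDiagram n) (i : ℕ) (hi : i + 1 < n) : Prop :=
  ¬ a.IsOpening ⟨i, by omega⟩ ∧ a.IsOpening ⟨i + 1, hi⟩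

/-- `b` is the result of the box addition at position `i + 1` on `a`: `a` has a minimum there, and
the path of `b` arises by replacing the downward step by an upward one and the upward step after it
by a downward one. -/
structure IsBoxAddition (i : ℕ) (hi : i + 1 < n) (a b : HalfDiagram n) : Prop where
  hasMinimum : a.HasMinimum i hi
  opening : b.IsOpening ⟨i, by omega⟩
  closing : ¬ b.IsOpening ⟨i + 1, hi⟩
  other : ∀ k : Fin n, k.val ≠ i → k.val ≠ i + 1 → (b.IsOpening k ↔ a.IsOpening k)

end HalfDiagram

/-- The value at `q` of the `k`-th Chebyshev polynomial, with `Δ₋₁ = 0`, `Δ₀ = 1` and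
`Δₖ₊₁ = q Δₖ - Δₖ₋₁`. -/
noncomputable def chebDelta (q : ℝ) (k : ℤ) : ℝ := (Polynomial.Chebyshev.S ℝ k).eval q

/-- `μₖ = Δₖ₋₁ / Δₖ`. -/
noncomputable def chebMu (q : ℝ) (k : ℤ) : ℝ := chebDelta q (k - 1) / chebDelta q k

/-- The quotients `μ` that occur in white box additions on half-diagrams on `n` points with `p`
arches are well-defined at `q`. -/
def MuDefined (q : ℝ) (n p : ℕ) : Prop :=
  ∀ (a : HalfDiagram n) (i : ℕ) (hi : i + 1 < n), a.numPairs = p → a.HasMinimum i hi →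
    chebDelta q (a.height (i + 1) + 1) ≠ 0

/-- `IsWhiteBox q a v`: the vector `v` of `U(n)` is obtained as `ξ'_a`, that is, from the basis element
of a minimal diagram by a sequence of white box additions that leads to `a`. -/
inductive IsWhiteBox {n : ℕ} (q : ℝ) : HalfDiagram n → HalfSpace n → Prop
  | minimal (a : HalfDiagram n) (ha : a.IsMinimal) : IsWhiteBox q a (Finsupp.single a 1)
  | box (a b : HalfDiagram n) (v : HalfSpace n) (i : ℕ) (hi : i + 1 < n)
      (hv : IsWhiteBox q a v) (hab : HalfDiagram.IsBoxAddition i hi a b) :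
      IsWhiteBox q b (tlAct q (tlGen i hi) v - (chebMu q (a.height (i + 1) + 1) : ℂ) • v)

/-! Everything follows from the action of `e_i` on the vectors ξ'. If the brackets of `a` at i and
i+1 agree (a slope), `e_i` kills ξ'_a; at a peak starting from height 0 it multiplies ξ'_a by q
(`tlAct_whiteBoxVector`). At a minimum, e_i ξ'_a = ξ'_{◇_i a} + μ ξ'_a by definition; at any other
peak a = ◇_i d, and e_i² = q e_i gives a combination of ξ'_a and ξ'_d. The slope case is an
induction on boxes resting on e_i e_j e_i = e_i for adjacent i, j and on μ_{k+1}(q - μ_k) = 1; this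
is where admissibility enters.

Well-definedness is confluence: two different last boxes lie at nonadjacent places and come from a
common half-diagram (`IsBoxAddition.diamond`), and their generators commute.

For orthogonality, the `e_i` are self-adjoint (`halfForm_tlAct`). If b = ◇_i c, then ⟨ξ'_a, ξ'_b⟩ =
⟨e_i ξ'_a, ξ'_c⟩ - μ⟨ξ'_a, ξ'_c⟩, and e_i ξ'_a involves only `a` and its neighbour across a box at
i, neither of which is `c` unless a = c. This reduces `b` to a minimal half-diagram m. For m ≠ a, at
the first difference of the bracket sequences one vector is killed by some `e_i`, while the other is
an eigenvector for q or loses a box. Only bracket sequences are compared, so the numbers of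
through-strings play no role. -/

/-! ### Joining two points of an involution -/

section capFun

variable {ι : Type*} [DecidableEq ι]

/-- The map obtained from an involution `α` by joining `u` to `v`, and the former partner of `u` to
the former partner of `v`. If only one of `u`, `v` is a fixed point, the partner of the other becomes
a fixed point. -/
def capFun (u v : ι) (α : ι → ι) (k : ι) : ι :=
  if k = u then v else if k = v then u
  else if k = α u then (if α v = v then k else α v)
  else if k = α v then (if α u = u then k else α u)
  else α k

theorem capFun_comm (u v : ι) (α : ι → ι) :
    capFun u v α = capFun v u α := by
  funext k
  unfold capFun
  grind

theorem capFun_capFun_self {u v : ι} (huv : u ≠ v) (α : ι → ι) (hα : ∀ k, α (α k) = k) (k : ι) :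
    capFun u v α (capFun u v α k) = k := by
  unfold capFun
  grind

theorem capFun_of_arch {u v : ι} (α : ι → ι) (hα : ∀ k, α (α k) = k) (h : α u = v) :
    capFun u v α = α := by
  funext k
  unfold capFun
  grind

/-- Straightening a zigzag: this becomes the relation e_i e_j e_i = e_i. -/
theorem capFun_capFun_of_arch {u v w : ι} (huv : u ≠ v) (huw : u ≠ w) (hvw : v ≠ w)
    (α : ι → ι) (hα : ∀ k, α (α k) = k) (h : α u = v) :
    capFun u v (capFun v w α) = α := by
  funext k
  unfold capFun
  grind

theorem capFun_capFun_comm {u v u' v' : ι} (huv : u ≠ v) (huv' : u' ≠ v') (h1 : u ≠ u')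
    (h2 : u ≠ v') (h3 : v ≠ u') (h4 : v ≠ v') (α : ι → ι) (hα : ∀ k, α (α k) = k) :
    capFun u v (capFun u' v' α) = capFun u' v' (capFun u v α) := by
  funext k
  grind (splits := 40) [capFun]

end capFun

/-! ### Noncrossing involutions and the half-diagram left by a generator -/

namespace HalfDiagram

variable {n : ℕ}

/-- A point below an arch is joined to another point below that arch. -/
theorem nested (a : HalfDiagram n) {s t : Fin n} (h1 : s < t) (h2 : t < a.partner s) :
    s < a.partner t ∧ a.partner t < a.partner s ∧ a.partner t ≠ t := by
  have e1 := a.partner_partner t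
  have e2 := a.partner_partner s
  have h3 := a.arch_arch s t
  have h4 := a.arch_through s t
  have h5 := a.arch_arch (a.partner t) s
  have h6 : a.partner t ≠ s := by grind
  have h7 : a.partner t ≠ a.partner s := by grind
  grind

theorem nested_iff (α : Fin n → Fin n) :
    (∀ s t, s < t → t < α s → s < α t ∧ α t < α s ∧ α t ≠ t) →
    (∀ i k, ¬ (i < k ∧ k < α i ∧ α i < α k)) ∧ ∀ i k, ¬ (i < k ∧ k < α i ∧ α k = k) := by
  intro h
  exact ⟨fun i k hk => by have := h i k hk.1 hk.2.1; grind,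
    fun i k hk => (h i k hk.1 hk.2.1).2.2 hk.2.2⟩

/-- No point lies between `u` and `v`, and the new arch between their former partners runs along the
two old strings, so nothing can cross it. -/
theorem capFun_nested (α : Fin n → Fin n) (hα : ∀ k, α (α k) = k)
    (h : ∀ s t, s < t → t < α s → s < α t ∧ α t < α s ∧ α t ≠ t) {u v : Fin n}
    (huv : u.val + 1 = v.val) (s t : Fin n) (h1 : s < t) (h2 : t < capFun u v α s) :
    s < capFun u v α t ∧ capFun u v α t < capFun u v α s ∧ capFun u v α t ≠ t := by
  have hs : s ≠ u := by rintro rfl; grind [capFun]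
  have hs' : s ≠ v := by rintro rfl; grind [capFun]
  by_cases hsu : s = α u
  · have es : capFun u v α s = α v := by grind [capFun]
    have hvv : α v ≠ v := by grind [capFun]
    -- The strings leave `u` to the left and `v` to the right; the new arch spans both points.
    have h3 : s < u := by
      have := h u v; grind
    have h4 : v < α v := by
      have := h s v; have := h (α v) u; grind
    rw [es] at h2 ⊢
    have := h s t; have := h v t
    grind [capFun]
  by_cases hsv : s = α v
  · have es : capFun u v α s = α u := by grind [capFun]
    have huu : α u ≠ u := by grind [capFun]
    rw [es] at h2 ⊢
    have ht : capFun u v α t = α t := by grind [capFun]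
    rw [ht]
    have e1 := hα u; have e2 := hα v; have e3 := hα t
    -- Both strings leave to the same side, one inside the other: to the left if `s < u`, otherwise
    -- to the right.
    rcases lt_or_gt_of_ne hs with h3 | h3
    · have := h s u; have := h s t; have := h (α u) (α t)
      grind
    · have := h u s; have := h u t; have := h v (α t)
      grind
  have es : capFun u v α s = α s := by grind [capFun]
  rw [es] at h2 ⊢
  have := h s t h1 h2
  have h3 : α s ≠ u := by grind
  have h4 : α s ≠ v := by grind
  have := h s u
  have := h s v
  by_cases htu : t = u
  · grind [capFun]
  by_cases htv : t = v
  · grind [capFun]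
  by_cases htxu : t = α u
  · grind [capFun]
  by_cases htxv : t = α v
  · grind [capFun]
  grind [capFun]

/-- The half-diagram left by the generator `e_{i+1}` on `a`. -/
def cap (a : HalfDiagram n) (i : ℕ) (hi : i + 1 < n) : HalfDiagram n where
  partner := capFun ⟨i, by omega⟩ ⟨i + 1, hi⟩ a.partner
  partner_partner := capFun_capFun_self (by simp) _ a.partner_partner
  arch_arch := (nested_iff _ (capFun_nested a.partner a.partner_partner
    (fun _ _ => a.nested) rfl)).1
  arch_through := (nested_iff _ (capFun_nested a.partner a.partner_partner
    (fun _ _ => a.nested) rfl)).2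

end HalfDiagram

/-- The map obtained from an involution `α` with `α u = v` by joining `u` to `x`, and `v` to the
former partner of `x`. -/
def uncapFun {ι : Type*} [DecidableEq ι] (u v x : ι) (α : ι → ι) (k : ι) : ι :=
  if k = u then x else if k = x then u
  else if k = v then (if α x = x then v else α x)
  else if k = α x then v else α k

theorem uncapFun_uncapFun_self {ι : Type*} [DecidableEq ι] {u v x : ι} (huv : u ≠ v) (hux : u ≠ x)
    (hvx : v ≠ x) (α : ι → ι) (hα : ∀ k, α (α k) = k) (h : α u = v) (k : ι) :
    uncapFun u v x α (uncapFun u v x α k) = k := by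
  unfold uncapFun
  grind

/-! ### Bracket sequences, adding and removing boxes -/

namespace HalfDiagram

variable {n : ℕ}

/-- By `hmax` the points between `x` and `u` are matched among themselves, so `x` can be joined to
`u`. The string of `x` passed over `v`, or was a through-string, and can start at `v` instead. -/
theorem uncapFun_nested (α : Fin n → Fin n) (hα : ∀ k, α (α k) = k)
    (h : ∀ s t, s < t → t < α s → s < α t ∧ α t < α s ∧ α t ≠ t) {u v x : Fin n}
    (huv : u.val + 1 = v.val) (hu : α u = v) (hxu : x < u) (hx : α x = x ∨ v < α x)
    (hmax : ∀ z, x < z → z < u → α z ≠ z ∧ α z < u)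
    (s t : Fin n) (h1 : s < t) (h2 : t < uncapFun u v x α s) :
    s < uncapFun u v x α t ∧ uncapFun u v x α t < uncapFun u v x α s ∧ uncapFun u v x α t ≠ t := by
  have e1 := hα u; have e2 := hα x; have e3 := hα t; have e4 := hα s
  have hmt := hmax t
  have hmt' := hmax (α t)
  have hs : s ≠ u := by rintro rfl; grind [uncapFun]
  by_cases hsx : s = x
  · have es : uncapFun u v x α s = u := by grind [uncapFun]
    rw [es] at h2 ⊢
    have et : uncapFun u v x α t = α t := by grind [uncapFun]
    rw [et]
    have := h x t
    have := h (α t) x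
    grind
  by_cases hsv : s = v
  · have es : uncapFun u v x α s = α x := by grind [uncapFun]
    rw [es] at h2 ⊢
    have et : uncapFun u v x α t = α t := by grind [uncapFun]
    rw [et]
    have := h x t
    grind
  by_cases hsx' : s = α x
  · grind [uncapFun]
  have es : uncapFun u v x α s = α s := by grind [uncapFun]
  rw [es] at h2 ⊢
  have := h s t
  have := h s x
  have := h s u
  have := hmax s
  have h3 : α s ≠ u := by grind
  have h4 : α s ≠ v := by grind
  have h5 : α s ≠ x := by grind
  have h6 : α s ≠ α x := by grind
  have := h x s
  by_cases htu : t = u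
  · grind [uncapFun]
  by_cases htv : t = v
  · grind [uncapFun]
  by_cases htx : t = x
  · grind [uncapFun]
  by_cases htx' : t = α x
  · grind [uncapFun]
  grind [uncapFun]

/-- At the first closing bracket whose partners differ, the nearer partner lies below the other
diagram's arch. There it is joined to an earlier closing bracket, on which both diagrams already
agree: a contradiction. -/
theorem ext_of_isOpening {a b : HalfDiagram n} (h : ∀ k, a.IsOpening k ↔ b.IsOpening k) : a = b := by
  have key : ∀ (k : Fin n) (a' b' : HalfDiagram n), (∀ k, a'.IsOpening k ↔ b'.IsOpening k) →
      (∀ j < k, ¬ a'.IsOpening j → a'.partner j = b'.partner j) → ¬ a'.IsOpening k →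
      ¬ a'.partner k < b'.partner k := by
    intro k a' b' hab hk hc hlt
    have hc' := (not_congr (hab k)).1 hc
    unfold IsOpening at *
    have e1 := a'.partner_partner k
    have e2 := b'.partner_partner k
    have hn := a'.nested (s := a'.partner k) (t := b'.partner k) hlt (by grind)
    have e3 := a'.partner_partner (b'.partner k)
    have := hab (b'.partner k)
    have := hk (a'.partner (b'.partner k))
    have := b'.partner_partner (a'.partner (b'.partner k))
    grind
  have hclose : ∀ k : Fin n, ¬ a.IsOpening k → a.partner k = b.partner k := by
    intro k
    induction k using WellFoundedLT.induction with
    | ind k ih =>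
      intro hk
      rcases lt_trichotomy (a.partner k) (b.partner k) with h1 | h1 | h1
      · exact absurd h1 (key k a b h ih hk)
      · exact h1
      · refine absurd h1 (key k b a (fun k => (h k).symm)
          (fun j hj hj' => (ih j hj (by rwa [h j])).symm) (by rwa [← h k]))
  ext k
  congr 1
  by_cases hk : a.IsOpening k
  · have e1 := a.partner_partner k
    have e2 := b.partner_partner k
    have h1 := hclose (a.partner k)
    have h2 := hclose (b.partner k)
    have h3 := h (b.partner k)
    have h4 := h k
    have e3 := a.partner_partner (b.partner k)
    have e4 := b.partner_partner (a.partner k)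
    unfold IsOpening at *
    grind
  · exact hclose k hk

/-- If `v` were joined to a point before `u`, then `u` would need a later partner strictly before
`v`. -/
theorem partner_eq_of_isOpening {a : HalfDiagram n} {u v : Fin n} (huv : u.val + 1 = v.val)
    (hu : a.IsOpening u) (hv : ¬ a.IsOpening v) : a.partner u = v := by
  have e1 := a.partner_partner u
  have e2 := a.partner_partner v
  have := a.nested (s := a.partner v) (t := u)
  unfold IsOpening at *
  grind

theorem IsBoxAddition.unique_right {i : ℕ} {hi : i + 1 < n} {a b c : HalfDiagram n}
    (hb : IsBoxAddition i hi a b) (hc : IsBoxAddition i hi a c) : b = c := by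
  obtain ⟨_, h1, h2, h3⟩ := hb
  obtain ⟨_, h4, h5, h6⟩ := hc
  refine ext_of_isOpening fun k => ?_
  by_cases hk : k.val = i
  · rw [show k = ⟨i, by omega⟩ from Fin.ext hk]
    tauto
  by_cases hk' : k.val = i + 1
  · rw [show k = ⟨i + 1, hi⟩ from Fin.ext hk']
    tauto
  rw [h3 k hk hk', h6 k hk hk']

theorem IsBoxAddition.unique_left {i : ℕ} {hi : i + 1 < n} {a b c : HalfDiagram n}
    (hb : IsBoxAddition i hi b a) (hc : IsBoxAddition i hi c a) : b = c := by
  obtain ⟨⟨h1, h2⟩, _, _, h3⟩ := hb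
  obtain ⟨⟨h4, h5⟩, _, _, h6⟩ := hc
  refine ext_of_isOpening fun k => ?_
  by_cases hk : k.val = i
  · rw [show k = ⟨i, by omega⟩ from Fin.ext hk]
    tauto
  by_cases hk' : k.val = i + 1
  · rw [show k = ⟨i + 1, hi⟩ from Fin.ext hk']
    tauto
  rw [← h3 k hk hk', ← h6 k hk hk']

/-- At a minimum the two strings leave in opposite directions, so joining their far ends changes no
bracket other than the two at the minimum. -/
theorem isBoxAddition_cap {a : HalfDiagram n} {i : ℕ} {hi : i + 1 < n} (h : a.HasMinimum i hi) :
    IsBoxAddition i hi a (a.cap i hi) := by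
  have hu : (⟨i, by omega⟩ : Fin n).val + 1 = (⟨i + 1, hi⟩ : Fin n).val := rfl
  have hk1 : ∀ k : Fin n, k.val ≠ i → k ≠ ⟨i, by omega⟩ := fun k hk => by grind
  have hk2 : ∀ k : Fin n, k.val ≠ i + 1 → k ≠ ⟨i + 1, by omega⟩ := fun k hk => by grind
  refine ⟨h, ?_, ?_, fun k h3 h4 => ?_⟩
  · simp only [IsOpening, cap, capFun]
    simp
  · simp [IsOpening, cap, capFun]
  · have h5 := hk1 k h3
    have h6 := hk2 k h4
    clear hk1 hk2 h3 h4
    obtain ⟨h1, h2⟩ := h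
    unfold IsOpening cap at *
    dsimp only
    have h0 := a.partner_partner
    generalize (⟨i, by omega⟩ : Fin n) = u at *
    generalize (⟨i + 1, hi⟩ : Fin n) = v at *
    have e1 := h0 u
    have e2 := h0 v
    grind [capFun]

/-- A box can be removed at a peak as soon as some string is still open before it. -/
theorem exists_isBoxAddition {b : HalfDiagram n} {i : ℕ} {hi : i + 1 < n}
    (h1 : b.IsOpening ⟨i, by omega⟩) (h2 : ¬ b.IsOpening ⟨i + 1, hi⟩)
    (h : ∃ x : Fin n, x.val < i ∧ (b.partner x = x ∨ i ≤ (b.partner x).val)) :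
    ∃ c, IsBoxAddition i hi c b := by
  have hu : (⟨i, by omega⟩ : Fin n).val + 1 = (⟨i + 1, hi⟩ : Fin n).val := rfl
  have huv := partner_eq_of_isOpening hu h1 h2
  have hk1 : ∀ k : Fin n, k.val ≠ i → k ≠ ⟨i, by omega⟩ := fun k hk => by grind
  have hk2 : ∀ k : Fin n, k.val ≠ i + 1 → k ≠ ⟨i + 1, by omega⟩ := fun k hk => by grind
  -- The open string nearest to the peak is cut and reconnected to the two points of the peak.
  obtain ⟨x, hx⟩ := (Set.toFinite {x : Fin n | x.val < i ∧
    (b.partner x = x ∨ i ≤ (b.partner x).val)}).exists_maximal h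
  obtain ⟨⟨hxu, hx⟩, hmax⟩ := hx
  have h0 := b.partner_partner
  have hn := fun s t => b.nested (s := s) (t := t)
  have hmax' : ∀ z : Fin n, x < z → z < ⟨i, by omega⟩ → b.partner z ≠ z ∧
      b.partner z < ⟨i, by omega⟩ := by
    intro z hz hz'
    by_contra hcon
    have := @hmax z ⟨hz', by
      by_contra hcon'
      refine hcon ⟨fun h => hcon' (Or.inl h), ?_⟩
      rw [Fin.lt_def]
      simp only
      omega⟩ hz.le
    exact absurd this (not_le.2 hz)
  have hx' : b.partner x = x ∨ (⟨i + 1, hi⟩ : Fin n) < b.partner x := by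
    rcases hx with hx | hx
    · exact Or.inl hx
    · right
      have e1 := h0 x
      have e2 := h0 ⟨i, by omega⟩
      grind
  have hxu' : x < ⟨i, by omega⟩ := hxu
  refine ⟨⟨uncapFun ⟨i, by omega⟩ ⟨i + 1, hi⟩ x b.partner, ?_, ?_, ?_⟩, ⟨?_, ?_⟩, h1, h2, ?_⟩
  · refine uncapFun_uncapFun_self (by simp) (by grind) (by grind) _ h0 huv
  · exact (nested_iff _ (uncapFun_nested _ h0 hn hu huv hxu' hx' hmax')).1
  · exact (nested_iff _ (uncapFun_nested _ h0 hn hu huv hxu' hx' hmax')).2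
  · simp only [IsOpening, uncapFun]
    grind
  · simp only [IsOpening, uncapFun]
    grind
  · intro k h3 h4
    have h5 := hk1 k h3
    have h6 := hk2 k h4
    simp only [IsOpening, uncapFun]
    clear hk1 hk2 h3 h4 hmax hxu hx
    generalize (⟨i, by omega⟩ : Fin n) = u at *
    generalize (⟨i + 1, hi⟩ : Fin n) = v at *
    grind

end HalfDiagram

/-! ### Heights, the order of box additions, and minimal half-diagrams -/

namespace HalfDiagram

variable {n : ℕ}

theorem height_zero (a : HalfDiagram n) : a.height 0 = 0 := by simp [height]

theorem height_succ (a : HalfDiagram n) (k : Fin n) :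
    a.height (k.val + 1) = a.height k.val + if a.IsOpening k then 1 else -1 := by
  unfold height
  rw [← sub_eq_iff_eq_add', ← Finset.sum_sub_distrib, Finset.sum_eq_single k]
  · simp
  · intro j _ hj
    have : j.val ≠ k.val := fun h => hj (Fin.ext h)
    split_ifs <;> omega
  · simp

theorem height_congr {a b : HalfDiagram n} {m : ℕ}
    (h : ∀ k : Fin n, k.val < m → (a.IsOpening k ↔ b.IsOpening k)) : a.height m = b.height m := by
  refine Finset.sum_congr rfl fun k _ => ?_
  split_ifs <;> first | rfl | (have := h k; tauto)

/-- The height counts the points joined to infinity or to a later point. -/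
theorem height_eq_card (a : HalfDiagram n) (m : ℕ) : a.height m =
    (Finset.univ.filter fun k : Fin n =>
      k.val < m ∧ (a.partner k = k ∨ m ≤ (a.partner k).val)).card := by
  rw [Finset.card_filter, Nat.cast_sum, ← sub_eq_zero]
  unfold height
  rw [← Finset.sum_sub_distrib]
  -- Two joined points before `m` contribute +1 and -1; every other point contributes 0 to the
  -- difference.
  refine Finset.sum_involution (fun k _ => a.partner k) ?_ ?_ (by simp)
    (fun k _ => a.partner_partner k)
  · intro k _
    have h1 : a.IsOpening k ↔ k ≤ a.partner k := Iff.rfl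
    have h2 : a.IsOpening (a.partner k) ↔ a.partner k ≤ k := by
      rw [IsOpening, a.partner_partner]
    rw [a.partner_partner]
    grind
  · intro k _ hk hk'
    apply hk
    have h1 : a.IsOpening k := hk'.ge
    grind

theorem height_nonneg (a : HalfDiagram n) (m : ℕ) : 0 ≤ a.height m := by
  rw [height_eq_card]
  positivity

theorem exists_of_height_pos {a : HalfDiagram n} {m : ℕ} (h : 0 < a.height m) :
    ∃ x : Fin n, x.val < m ∧ (a.partner x = x ∨ m ≤ (a.partner x).val) := by
  rw [height_eq_card, Nat.cast_pos, Finset.card_pos] at h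
  obtain ⟨x, hx⟩ := h
  exact ⟨x, by simpa using hx⟩

theorem height_pos_of_closing {a : HalfDiagram n} {k : Fin n} (h : ¬ a.IsOpening k) :
    1 ≤ a.height k.val := by
  have h1 := a.height_succ k
  have h2 := a.height_nonneg (k.val + 1)
  rw [if_neg h] at h1
  omega

theorem IsBoxAddition.isOpening_swap {i : ℕ} {hi : i + 1 < n} {a b : HalfDiagram n}
    (h : IsBoxAddition i hi a b) (k : Fin n) :
    b.IsOpening k ↔ a.IsOpening (Equiv.swap ⟨i, by omega⟩ ⟨i + 1, hi⟩ k) := by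
  obtain ⟨⟨h1, h2⟩, h3, h4, h5⟩ := h
  by_cases hk : k.val = i
  · rw [show k = ⟨i, by omega⟩ from Fin.ext hk, Equiv.swap_apply_left]
    tauto
  by_cases hk' : k.val = i + 1
  · rw [show k = ⟨i + 1, hi⟩ from Fin.ext hk', Equiv.swap_apply_right]
    tauto
  rw [h5 k hk hk', Equiv.swap_apply_of_ne_of_ne] <;> grind

theorem IsBoxAddition.height_eq {i : ℕ} {hi : i + 1 < n} {a b : HalfDiagram n}
    (h : IsBoxAddition i hi a b) {m : ℕ} (hm : m ≠ i + 1) : b.height m = a.height m := by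
  unfold height
  rw [← Equiv.sum_comp (Equiv.swap (⟨i, by omega⟩ : Fin n) ⟨i + 1, hi⟩)]
  refine Finset.sum_congr rfl fun k _ => ?_
  have h1 := h.isOpening_swap (Equiv.swap ⟨i, by omega⟩ ⟨i + 1, hi⟩ k)
  rw [Equiv.swap_apply_self] at h1
  simp only [h1]
  congr 1
  rw [Equiv.swap_apply_def]
  grind

theorem numPairs_eq_card_closing (a : HalfDiagram n) :
    a.numPairs = (Finset.univ.filter fun k : Fin n => ¬ a.IsOpening k).card := by
  refine Finset.card_nbij' a.partner a.partner ?_ ?_ ?_ ?_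
  · intro k hk
    simpa [IsOpening, a.partner_partner] using hk
  · intro k hk
    simpa [IsOpening, a.partner_partner] using hk
  · intro k _
    exact a.partner_partner k
  · intro k _
    exact a.partner_partner k

theorem IsBoxAddition.numPairs_eq {i : ℕ} {hi : i + 1 < n} {a b : HalfDiagram n}
    (h : IsBoxAddition i hi a b) : b.numPairs = a.numPairs := by
  rw [numPairs_eq_card_closing, numPairs_eq_card_closing]
  refine Finset.card_equiv (Equiv.swap ⟨i, by omega⟩ ⟨i + 1, hi⟩) fun k => ?_
  simp [h.isOpening_swap k]

/-- The sum of the positions of the closing brackets. -/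
def closingSum (a : HalfDiagram n) : ℕ := ∑ k : Fin n, if a.IsOpening k then 0 else k.val

theorem IsBoxAddition.closingSum_lt {i : ℕ} {hi : i + 1 < n} {a b : HalfDiagram n}
    (h : IsBoxAddition i hi a b) : a.closingSum < b.closingSum := by
  unfold closingSum
  rw [← Equiv.sum_comp (Equiv.swap (⟨i, by omega⟩ : Fin n) ⟨i + 1, hi⟩)
    (fun k => if b.IsOpening k then 0 else k.val)]
  have h1 : ∀ k, b.IsOpening (Equiv.swap ⟨i, by omega⟩ ⟨i + 1, hi⟩ k) ↔ a.IsOpening k := by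
    intro k
    rw [h.isOpening_swap, Equiv.swap_apply_self]
  simp only [h1]
  obtain ⟨⟨h2, h3⟩, _⟩ := h
  refine Finset.sum_lt_sum (fun k _ => ?_) ⟨⟨i, by omega⟩, Finset.mem_univ _, ?_⟩
  · rw [Equiv.swap_apply_def]
    grind
  · simp [h2]

/-- Two box additions with the same result arise from a common half-diagram. -/
theorem IsBoxAddition.diamond {i j : ℕ} {hi : i + 1 < n} {hj : j + 1 < n} {a b c : HalfDiagram n}
    (ha : IsBoxAddition i hi a c) (hb : IsBoxAddition j hj b c) (hij : i ≠ j) :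
    (i + 1 < j ∨ j + 1 < i) ∧ ∃ d, IsBoxAddition j hj d a ∧ IsBoxAddition i hi d b := by
  have hij' : i + 1 < j ∨ j + 1 < i := by
    have h1 : i + 1 ≠ j := by
      rintro rfl
      exact ha.closing hb.opening
    have h2 : j + 1 ≠ i := by
      rintro rfl
      exact hb.closing ha.opening
    omega
  refine ⟨hij', ?_⟩
  have h1 : a.IsOpening ⟨j, by omega⟩ :=
    (ha.other ⟨j, by omega⟩ (by simp; omega) (by simp; omega)).1 hb.opening
  have h2 : ¬ a.IsOpening ⟨j + 1, hj⟩ := fun h =>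
    hb.closing ((ha.other ⟨j + 1, by omega⟩ (by simp; omega) (by simp; omega)).2 h)
  have h3 : 0 < a.height j := by
    have h4 := ha.height_eq (m := j) (by omega)
    have h5 := hb.height_eq (m := j) (by omega)
    have h6 := height_pos_of_closing hb.hasMinimum.1
    simp only at h6
    omega
  obtain ⟨d, hd⟩ := exists_isBoxAddition h1 h2 (exists_of_height_pos h3)
  refine ⟨d, hd, ⟨⟨?_, ?_⟩, ?_, ?_, fun k hk hk' => ?_⟩⟩
  · rw [← hd.other ⟨i, by omega⟩ (by simp; omega) (by simp; omega)]
    exact ha.hasMinimum.1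
  · rw [← hd.other ⟨i + 1, by omega⟩ (by simp; omega) (by simp; omega)]
    exact ha.hasMinimum.2
  · rw [← hb.other ⟨i, by omega⟩ (by simp; omega) (by simp; omega)]
    exact ha.opening
  · rw [← hb.other ⟨i + 1, by omega⟩ (by simp; omega) (by simp; omega)]
    exact ha.closing
  · by_cases h4 : k.val = j
    · rw [show k = ⟨j, by omega⟩ from Fin.ext h4]
      exact iff_of_false hb.hasMinimum.1 hd.hasMinimum.1
    by_cases h5 : k.val = j + 1
    · rw [show k = ⟨j + 1, by omega⟩ from Fin.ext h5]
      exact iff_of_true hb.hasMinimum.2 hd.hasMinimum.2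
    rw [← hb.other k h4 h5, ← hd.other k h4 h5, ha.other k hk hk']

theorem not_isBoxAddition_of_isMinimal {i : ℕ} {hi : i + 1 < n} {a b : HalfDiagram n}
    (hb : b.IsMinimal) : ¬ IsBoxAddition i hi a b := by
  intro h
  have h1 := hb _ h.closing
  have h2 := b.height_succ ⟨i, by omega⟩
  rw [if_pos h.opening] at h2
  have h3 := h.height_eq (m := i) (by omega)
  have h4 := height_pos_of_closing h.hasMinimum.1
  simp only at h1 h2 h4
  omega

/-- A half-diagram that is not minimal arises by a box addition. -/
theorem exists_isBoxAddition_of_not_isMinimal {b : HalfDiagram n} (hb : ¬ b.IsMinimal) :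
    ∃ (i : ℕ) (hi : i + 1 < n) (a : HalfDiagram n), IsBoxAddition i hi a b := by
  unfold IsMinimal at hb
  push Not at hb
  -- The first closing bracket at height at least 2 follows an opening one, since a closing bracket
  -- before it would be still higher. This is a peak starting at positive height.
  obtain ⟨k, hk⟩ := (Set.toFinite {k : Fin n | ¬ b.IsOpening k ∧ b.height k ≠ 1}).exists_minimal hb
  obtain ⟨⟨hk, hk1⟩, hmin⟩ := hk
  have h1 := height_pos_of_closing hk
  obtain ⟨k, hkn⟩ := k
  obtain _ | i := k
  · simp [height_zero] at h1
  have h2 := b.height_succ ⟨i, by omega⟩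
  simp only at h1 hk1 h2
  have h3 : b.IsOpening ⟨i, by omega⟩ := by
    by_contra h3
    rw [if_neg h3] at h2
    have := @hmin ⟨i, by omega⟩ ⟨h3, by simp only; omega⟩ (by simp [Fin.le_def])
    simp [Fin.le_def] at this
  rw [if_pos h3] at h2
  obtain ⟨c, hc⟩ := exists_isBoxAddition (hi := hkn) h3 hk (exists_of_height_pos (by omega))
  exact ⟨i, hkn, c, hc⟩

theorem IsMinimal.not_closing_closing {m : HalfDiagram n} (hm : m.IsMinimal) {i : ℕ}
    {hi : i + 1 < n} (h1 : ¬ m.IsOpening ⟨i, by omega⟩) : m.IsOpening ⟨i + 1, hi⟩ := by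
  by_contra h2
  have h3 := hm _ h1
  have h4 := hm _ h2
  have h5 := m.height_succ ⟨i, by omega⟩
  rw [if_neg h1] at h5
  simp only at *
  omega

theorem IsMinimal.through_through {m : HalfDiagram n} (hm : m.IsMinimal) {i : ℕ}
    {hi : i + 1 < n} (h1 : m.IsOpening ⟨i, by omega⟩) (h2 : m.IsOpening ⟨i + 1, hi⟩) :
    m.partner ⟨i, by omega⟩ = ⟨i, by omega⟩ ∧ m.partner ⟨i + 1, hi⟩ = ⟨i + 1, hi⟩ := by
  have huv : (⟨i, by omega⟩ : Fin n).val + 1 = (⟨i + 1, hi⟩ : Fin n).val := rfl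
  generalize (⟨i, by omega⟩ : Fin n) = u at *
  generalize (⟨i + 1, hi⟩ : Fin n) = v at *
  -- If the strings of `u` and `v` were both open just before a closing bracket, the height there
  -- would be at least 2.
  have key : ∀ w : Fin n, ¬ m.IsOpening w → ¬ ((u < w ∧ (m.partner u = u ∨ w ≤ m.partner u)) ∧
      (v < w ∧ (m.partner v = v ∨ w ≤ m.partner v))) := by
    rintro w hw ⟨hu, hv⟩
    have h3 := hm w hw
    rw [height_eq_card] at h3
    have h4 : ({u, v} : Finset (Fin n)).card ≤ _ := Finset.card_le_card
      (t := Finset.univ.filter fun k : Fin n =>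
      k.val < w.val ∧ (m.partner k = k ∨ w.val ≤ (m.partner k).val)) (by
        intro k hk
        rw [Finset.mem_insert, Finset.mem_singleton] at hk
        rw [Finset.mem_filter]
        rcases hk with rfl | rfl
        · exact ⟨Finset.mem_univ _, hu⟩
        · exact ⟨Finset.mem_univ _, hv⟩)
    rw [Finset.card_pair (by grind)] at h4
    omega
  have e1 := m.partner_partner u
  have e2 := m.partner_partner v
  have h3 := m.nested (s := u) (t := v)
  have h4 := key (m.partner v)
  unfold IsOpening at *
  grind

end HalfDiagram

/-! ### Components of graphs and the action of a generator on basis elements -/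

/-- Reachability is the least equivalence relation containing `r`. This is how paths are excluded;
their existence is shown by exhibiting edges. -/
theorem rel_of_reachable_fromRel {V : Type*} {r S : V → V → Prop} (hS : Equivalence S)
    (h : ∀ x y, r x y → S x y) {x y : V} (hxy : (SimpleGraph.fromRel r).Reachable x y) : S x y := by
  obtain ⟨w⟩ := hxy
  induction w with
  | nil => exact hS.refl _
  | cons hadj _ ih =>
    rw [SimpleGraph.fromRel_adj] at hadj
    exact hS.trans (hadj.2.elim (h _ _) fun h' => hS.symm (h _ _ h')) ih

theorem reachable_fromRel {V : Type*} {r : V → V → Prop} {x y : V} (h : r x y) :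
    (SimpleGraph.fromRel r).Reachable x y := by
  by_cases hxy : x = y
  · rw [hxy]
  · exact SimpleGraph.Adj.reachable ((SimpleGraph.fromRel_adj _ _ _).2 ⟨hxy, Or.inl h⟩)

theorem eq_of_reachable_fromRel {V W : Type*} {r : V → V → Prop} (f : V → W)
    (h : ∀ x y, r x y → f x = f y) {x y : V} (hxy : (SimpleGraph.fromRel r).Reachable x y) :
    f x = f y :=
  rel_of_reachable_fromRel (S := fun x y => f x = f y)
    ⟨fun _ => rfl, fun h => h.symm, fun h h' => h.trans h'⟩ h hxy

/-- A representative of the points joined to the right arch of `e_{i+1}`, other than the points of that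
arch. -/
def capRep {n : ℕ} (a : HalfDiagram n) (u v : Fin n) : Fin n :=
  if a.partner u = u then a.partner v else a.partner u

/-- The component of the concatenation of `e_{i+1}` and `a`, described by the points on the left. -/
def concatLabel {n : ℕ} (a : HalfDiagram n) (i : ℕ) (hi : i + 1 < n) : Fin n ⊕ Fin n → Finset (Fin n)
  | Sum.inl k => {k, (a.cap i hi).partner k}
  | Sum.inr k => if k = ⟨i, by omega⟩ ∨ k = ⟨i + 1, hi⟩ then
      (if a.partner ⟨i, by omega⟩ = ⟨i + 1, hi⟩ then ∅ else
        {capRep a ⟨i, by omega⟩ ⟨i + 1, hi⟩,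
          (a.cap i hi).partner (capRep a ⟨i, by omega⟩ ⟨i + 1, hi⟩)})
      else {k, (a.cap i hi).partner k}

/-- The scalar by which `e_{i+1}` maps `ξ_a` to a multiple of a basis element. -/
noncomputable def capCoeff {n : ℕ} (q : ℝ) (a : HalfDiagram n) (i : ℕ) (hi : i + 1 < n) : ℂ :=
  if a.partner ⟨i, by omega⟩ = ⟨i + 1, hi⟩ then (q : ℂ)
  else if a.partner ⟨i, by omega⟩ = ⟨i, by omega⟩ ∧ a.partner ⟨i + 1, hi⟩ = ⟨i + 1, hi⟩ then 0
  else 1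

section concat

variable {n : ℕ} (a : HalfDiagram n) (i : ℕ) (hi : i + 1 < n)

theorem concat_reachable_partner {p : TLDiagram n} (x : Fin n ⊕ Fin n) :
    (concatGraph p a).Reachable x (p.partner x) := reachable_fromRel (Or.inl rfl)

theorem concat_reachable_inr {p : TLDiagram n} (k : Fin n) :
    (concatGraph p a).Reachable (Sum.inr k) (Sum.inr (a.partner k)) :=
  reachable_fromRel (Or.inr ⟨k, rfl, rfl⟩)

theorem tlGen_partner_inl (k : Fin n) : (tlGen i hi).partner (Sum.inl k) =
    if k = ⟨i, by omega⟩ then Sum.inl ⟨i + 1, hi⟩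
    else if k = ⟨i + 1, hi⟩ then Sum.inl ⟨i, by omega⟩ else Sum.inr k := by
  simp [tlGen, Fin.ext_iff]

theorem tlGen_partner_inr (k : Fin n) : (tlGen i hi).partner (Sum.inr k) =
    if k = ⟨i, by omega⟩ then Sum.inr ⟨i + 1, hi⟩
    else if k = ⟨i + 1, hi⟩ then Sum.inr ⟨i, by omega⟩ else Sum.inl k := by
  simp [tlGen, Fin.ext_iff]

/-- A map is constant on the components of the concatenation of `e_{i+1}` and `a` if it is constant on
the edges. -/
theorem eq_of_concat_reachable {W : Type*} (f : Fin n ⊕ Fin n → W)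
    (h1 : f (Sum.inl ⟨i, by omega⟩) = f (Sum.inl ⟨i + 1, hi⟩))
    (h2 : f (Sum.inr ⟨i, by omega⟩) = f (Sum.inr ⟨i + 1, hi⟩))
    (h3 : ∀ k : Fin n, k ≠ ⟨i, by omega⟩ → k ≠ ⟨i + 1, hi⟩ → f (Sum.inl k) = f (Sum.inr k))
    (h4 : ∀ k : Fin n, f (Sum.inr k) = f (Sum.inr (a.partner k))) {x y : Fin n ⊕ Fin n}
    (hxy : (concatGraph (tlGen i hi) a).Reachable x y) : f x = f y := by
  refine eq_of_reachable_fromRel f ?_ hxy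
  rintro x y (h | ⟨k, rfl, rfl⟩)
  · subst h
    rcases x with k | k
    · rw [tlGen_partner_inl]
      grind
    · rw [tlGen_partner_inr]
      grind
  · exact h4 k

variable {a i hi}

/-- The label is constant along edges, so points with different labels are not connected. -/
theorem concatLabel_eq {x y : Fin n ⊕ Fin n}
    (hxy : (concatGraph (tlGen i hi) a).Reachable x y) :
    concatLabel a i hi x = concatLabel a i hi y := by
  have huv : (⟨i, by omega⟩ : Fin n) ≠ ⟨i + 1, hi⟩ := by simp
  have h0 := a.partner_partner
  have hc : (a.cap i hi).partner = capFun ⟨i, by omega⟩ ⟨i + 1, hi⟩ a.partner := rfl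
  refine eq_of_concat_reachable a i hi _ ?_ ?_ ?_ ?_ hxy
  · simp only [concatLabel, hc]
    grind [capFun]
  · simp [concatLabel]
  · intro k hk hk'
    simp [concatLabel, hk, hk']
  · intro k
    have h1 := h0 ⟨i, by omega⟩
    have h2 := h0 ⟨i + 1, hi⟩
    have h3 := h0 k
    simp only [concatLabel, hc, capRep]
    generalize (⟨i, by omega⟩ : Fin n) = u at *
    generalize (⟨i + 1, hi⟩ : Fin n) = v at *
    by_cases hku : k = u
    · grind [capFun]
    by_cases hkv : k = v
    · grind [capFun]
    by_cases hku' : k = a.partner u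
    · grind [capFun]
    by_cases hkv' : k = a.partner v
    · grind [capFun]
    have h4 : a.partner k ≠ u := by grind
    have h5 : a.partner k ≠ v := by grind
    have h6 : capFun u v a.partner k = a.partner k := by grind [capFun]
    have h7 : capFun u v a.partner (a.partner k) = k := by grind [capFun]
    simp only [hku, hkv, h4, h5, or_self, if_false, h6, h7]
    exact Finset.pair_comm _ _

theorem concatVanishes_of_through (h1 : a.partner ⟨i, by omega⟩ = ⟨i, by omega⟩)
    (h2 : a.partner ⟨i + 1, hi⟩ = ⟨i + 1, hi⟩) : ConcatVanishes (tlGen i hi) a := by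
  refine ⟨_, _, by simp, h1, h2, ?_⟩
  have := concat_reachable_partner a (p := tlGen i hi) (Sum.inr ⟨i, by omega⟩)
  simpa [tlGen_partner_inr] using this

theorem not_concatVanishes (h : ¬ (a.partner ⟨i, by omega⟩ = ⟨i, by omega⟩ ∧
      a.partner ⟨i + 1, hi⟩ = ⟨i + 1, hi⟩)) : ¬ ConcatVanishes (tlGen i hi) a := by
  rintro ⟨s, t, hst, hs, ht, hr⟩
  have hl := concatLabel_eq hr
  have huv : (⟨i, by omega⟩ : Fin n) ≠ ⟨i + 1, hi⟩ := by simp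
  have h0 := a.partner_partner
  have hc : (a.cap i hi).partner = capFun ⟨i, by omega⟩ ⟨i + 1, hi⟩ a.partner := rfl
  have h1 := h0 ⟨i, by omega⟩
  have h2 := h0 ⟨i + 1, hi⟩
  simp only [concatLabel, hc, capRep] at hl
  generalize (⟨i, by omega⟩ : Fin n) = u at *
  generalize (⟨i + 1, hi⟩ : Fin n) = v at *
  have key : ∀ k, a.partner k = k → k ≠ u → k ≠ v → capFun u v a.partner k = k := by
    grind [capFun]
  grind [capFun]

theorem isConcat_cap : IsConcat (tlGen i hi) a (a.cap i hi) := by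
  intro s t hst
  constructor
  · rintro rfl
    have huv : (⟨i, by omega⟩ : Fin n) ≠ ⟨i + 1, hi⟩ := by simp
    have hc : (a.cap i hi).partner = capFun ⟨i, by omega⟩ ⟨i + 1, hi⟩ a.partner := rfl
    have hp := concat_reachable_partner a (p := tlGen i hi)
    have ha := concat_reachable_inr a (p := tlGen i hi)
    have hpl := tlGen_partner_inl i hi
    have hpr := tlGen_partner_inr i hi
    have h0 := a.partner_partner
    have h1 := h0 ⟨i, by omega⟩
    have h2 := h0 ⟨i + 1, hi⟩
    rw [hc] at hst ⊢
    generalize (⟨i, by omega⟩ : Fin n) = u at *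
    generalize (⟨i + 1, hi⟩ : Fin n) = v at *
    have h3 : ∀ k, k ≠ u → k ≠ v → (concatGraph (tlGen i hi) a).Reachable (Sum.inl k) (Sum.inr k) := by
      intro k hk hk'
      have := hp (Sum.inl k)
      rwa [hpl, if_neg hk, if_neg hk'] at this
    have h4 : (concatGraph (tlGen i hi) a).Reachable (Sum.inl u) (Sum.inl v) := by
      have := hp (Sum.inl u)
      rwa [hpl, if_pos rfl] at this
    have h5 : (concatGraph (tlGen i hi) a).Reachable (Sum.inr u) (Sum.inr v) := by
      have := hp (Sum.inr u)
      rwa [hpr, if_pos rfl] at this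
    by_cases hsu : s = u
    · subst hsu
      simpa [capFun] using h4
    by_cases hsv : s = v
    · subst hsv
      simpa [capFun, huv.symm] using h4.symm
    have hxy : a.partner u ≠ u → a.partner u ≠ v → a.partner v ≠ v →
        (concatGraph (tlGen i hi) a).Reachable (Sum.inl (a.partner u)) (Sum.inl (a.partner v)) :=
      fun g1 g2 g3 => (h3 _ g1 g2).trans ((ha u).symm.trans (h5.trans ((ha v).trans
        (h3 _ (by grind) g3).symm)))
    by_cases hsu' : s = a.partner u
    · have e : capFun u v a.partner s = a.partner v := by grind [capFun]
      rw [e, hsu']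
      exact hxy (by grind) (by grind) (by grind [capFun])
    by_cases hsv' : s = a.partner v
    · have e : capFun u v a.partner s = a.partner u := by grind [capFun]
      rw [e, hsv']
      exact (hxy (by grind [capFun]) (by grind) (by grind [capFun])).symm
    have e : capFun u v a.partner s = a.partner s := by grind [capFun]
    rw [e]
    exact (h3 s hsu hsv).trans ((ha s).trans (h3 _ (by grind) (by grind)).symm)
  · intro hr
    have hl := concatLabel_eq hr
    simp only [concatLabel] at hl
    have h1 : t ∈ ({s, (a.cap i hi).partner s} : Finset (Fin n)) := by
      rw [hl]
      simp
    simp only [Finset.mem_insert, Finset.mem_singleton] at h1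
    exact (h1.resolve_left hst.symm).symm

/-- The right arch of the generator closes up with the arch of `a`; any other component contains a
left point. -/
theorem concatLoops_of_arch (h : a.partner ⟨i, by omega⟩ = ⟨i + 1, hi⟩) :
    concatLoops (tlGen i hi) a = 1 := by
  have huv : (⟨i, by omega⟩ : Fin n) ≠ ⟨i + 1, hi⟩ := by simp
  have h0 := a.partner_partner
  have h1 := h0 ⟨i, by omega⟩
  rw [concatLoops, Nat.card_eq_one_iff_exists]
  refine ⟨⟨(concatGraph (tlGen i hi) a).connectedComponentMk (Sum.inr ⟨i, by omega⟩), ?_⟩, ?_⟩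
  · intro k
    constructor
    · intro hk
      have := concatLabel_eq (SimpleGraph.ConnectedComponent.exact hk)
      simp [concatLabel, h] at this
    · intro hk hk'
      have := concatLabel_eq (SimpleGraph.ConnectedComponent.exact hk')
      have h2 : k ≠ ⟨i, by omega⟩ := by grind
      have h3 : k ≠ ⟨i + 1, hi⟩ := by grind
      simp [concatLabel, h, h2, h3] at this
  · rintro ⟨C, hC⟩
    ext1
    induction C using SimpleGraph.ConnectedComponent.ind with | _ x =>
    have hl := concat_reachable_partner a (p := tlGen i hi) x
    rcases x with k | k
    · exact absurd rfl (hC k).1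
    · rw [tlGen_partner_inr] at hl
      split_ifs at hl with h2 h3
      · exact congrArg (fun k => SimpleGraph.connectedComponentMk _ (Sum.inr k)) h2
      · exact SimpleGraph.ConnectedComponent.sound hl
      · exact absurd (SimpleGraph.ConnectedComponent.sound hl.symm) (hC k).1

/-- A right point off the arch is joined to the left point opposite, and from the arch one escapes
along an arch of `a`. -/
theorem concatLoops_eq_zero (h : ¬ (a.partner ⟨i, by omega⟩ = ⟨i, by omega⟩ ∧
      a.partner ⟨i + 1, hi⟩ = ⟨i + 1, hi⟩)) (h' : a.partner ⟨i, by omega⟩ ≠ ⟨i + 1, hi⟩) :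
    concatLoops (tlGen i hi) a = 0 := by
  have huv : (⟨i, by omega⟩ : Fin n) ≠ ⟨i + 1, hi⟩ := by simp
  have hp := concat_reachable_partner a (p := tlGen i hi)
  have ha := concat_reachable_inr a (p := tlGen i hi)
  have hpr := tlGen_partner_inr i hi
  have h0 := a.partner_partner
  have h1 := h0 ⟨i, by omega⟩
  have h2 := h0 ⟨i + 1, hi⟩
  rw [concatLoops, Nat.card_eq_zero]
  left
  constructor
  rintro ⟨C, hC⟩
  induction C using SimpleGraph.ConnectedComponent.ind with | _ x =>
  generalize (⟨i, by omega⟩ : Fin n) = u at *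
  generalize (⟨i + 1, hi⟩ : Fin n) = v at *
  suffices ∃ k, (concatGraph (tlGen i hi) a).Reachable x (Sum.inl k) by
    obtain ⟨k, hk⟩ := this
    exact (hC k).1 (SimpleGraph.ConnectedComponent.sound hk.symm)
  have h3 : ∀ k, k ≠ u → k ≠ v → (concatGraph (tlGen i hi) a).Reachable (Sum.inr k) (Sum.inl k) := by
    intro k hk hk'
    have := hp (Sum.inr k)
    rwa [hpr, if_neg hk, if_neg hk'] at this
  have h5 : (concatGraph (tlGen i hi) a).Reachable (Sum.inr u) (Sum.inr v) := by
    have := hp (Sum.inr u)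
    rwa [hpr, if_pos rfl] at this
  have hu : ∃ k, (concatGraph (tlGen i hi) a).Reachable (Sum.inr u) (Sum.inl k) := by
    by_cases hu : a.partner u = u
    · exact ⟨_, h5.trans ((ha v).trans (h3 (a.partner v) (by grind) (by grind)))⟩
    · exact ⟨_, (ha u).trans (h3 (a.partner u) (by grind) (by grind))⟩
  rcases x with k | k
  · exact ⟨k, SimpleGraph.Reachable.refl _⟩
  · by_cases hku : k = u
    · rwa [hku]
    by_cases hkv : k = v
    · rw [hkv]
      exact hu.imp fun k hk => h5.symm.trans hk
    exact ⟨k, h3 k hku hkv⟩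

/-- This replaces the graphs in the definition of the action by the explicit `cap` and `capCoeff`.
-/
theorem tlAct_single (q : ℝ) (a : HalfDiagram n) (i : ℕ) (hi : i + 1 < n) :
    tlAct q (tlGen i hi) (Finsupp.single a 1) =
      capCoeff q a i hi • Finsupp.single (a.cap i hi) 1 := by
  have huv : (⟨i, by omega⟩ : Fin n) ≠ ⟨i + 1, hi⟩ := by simp
  have h0 := a.partner_partner
  have h1 := h0 ⟨i, by omega⟩
  rw [tlAct, Finsupp.linearCombination_single, one_smul, tlActBasis]
  by_cases h : a.partner ⟨i, by omega⟩ = ⟨i, by omega⟩ ∧ a.partner ⟨i + 1, hi⟩ = ⟨i + 1, hi⟩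
  · rw [dif_neg fun hn => hn.1 (concatVanishes_of_through h.1 h.2), capCoeff, if_neg (by grind),
      if_pos h, zero_smul]
  · have hex : ¬ ConcatVanishes (tlGen i hi) a ∧ ∃ b, IsConcat (tlGen i hi) a b :=
      ⟨not_concatVanishes h, _, isConcat_cap⟩
    rw [dif_pos hex, hex.2.choose_spec.unique (isConcat_cap), capCoeff,
      Finsupp.smul_single, smul_eq_mul, mul_one]
    by_cases h' : a.partner ⟨i, by omega⟩ = ⟨i + 1, hi⟩
    · rw [concatLoops_of_arch h', if_pos h', pow_one]
    · rw [concatLoops_eq_zero h h', if_neg h', if_neg h, pow_zero]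

end concat

/-! ### The Temperley-Lieb relations on `U(n)` -/

section capCoeffFun

variable {ι : Type*} [DecidableEq ι]

/-- The scalar belonging to `capFun u v α`. -/
noncomputable def capCoeffFun (q : ℂ) (u v : ι) (α : ι → ι) : ℂ :=
  if α u = v then q else if α u = u ∧ α v = v then 0 else 1

theorem capCoeffFun_capFun_comm {u v u' v' : ι} (q : ℂ) (huv : u ≠ v) (huv' : u' ≠ v')
    (h1 : u ≠ u') (h2 : u ≠ v') (h3 : v ≠ u') (h4 : v ≠ v') (α : ι → ι) (hα : ∀ k, α (α k) = k) :
    capCoeffFun q u v α * capCoeffFun q u' v' (capFun u v α) =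
      capCoeffFun q u' v' α * capCoeffFun q u v (capFun u' v' α) := by
  have e1 := hα u
  have e2 := hα v
  have e3 := hα u'
  have e4 := hα v'
  unfold capCoeffFun
  by_cases c1 : α u = v
  · rw [capFun_of_arch α hα c1]
    have : capFun u' v' α u = v := by grind [capFun]
    simp only [this, c1, if_true]
    ring
  by_cases c2 : α u' = v'
  · rw [capFun_of_arch α hα c2]
    have : capFun u v α u' = v' := by grind [capFun]
    simp only [this, c2, if_true]
    ring
  by_cases c3 : α u = u ∧ α v = v
  · have : capFun u' v' α u = u ∧ capFun u' v' α v = v := by grind [capFun]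
    have : capFun u' v' α u ≠ v := by grind
    simp [*]
  by_cases c4 : α u' = u' ∧ α v' = v'
  · have : capFun u v α u' = u' ∧ capFun u v α v' = v' := by grind [capFun]
    have : capFun u v α u' ≠ v' := by grind
    simp [*]
  have key1 : capFun u v α u' = v' ↔ capFun u' v' α u = v := by grind [capFun]
  have key2 : (capFun u v α u' = u' ∧ capFun u v α v' = v') ↔
      (capFun u' v' α u = u ∧ capFun u' v' α v = v) := by grind (splits := 30) [capFun]
  simp only [key1, key2, c1, c2, c3, c4, if_false]

end capCoeffFun

section relations

variable {n : ℕ}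

theorem capCoeff_eq (q : ℝ) (a : HalfDiagram n) (i : ℕ) (hi : i + 1 < n) :
    capCoeff q a i hi = capCoeffFun (q : ℂ) ⟨i, by omega⟩ ⟨i + 1, hi⟩ a.partner := rfl

theorem cap_eq_self {a : HalfDiagram n} {i : ℕ} {hi : i + 1 < n}
    (h : a.partner ⟨i, by omega⟩ = ⟨i + 1, hi⟩) : a.cap i hi = a :=
  HalfDiagram.ext (capFun_of_arch _ a.partner_partner h)

theorem cap_partner (a : HalfDiagram n) (i : ℕ) (hi : i + 1 < n) :
    (a.cap i hi).partner ⟨i, by omega⟩ = ⟨i + 1, hi⟩ := by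
  simp [HalfDiagram.cap, capFun]

theorem tlAct_single_of_arch (q : ℝ) {a : HalfDiagram n} {i : ℕ} {hi : i + 1 < n}
    (h : a.partner ⟨i, by omega⟩ = ⟨i + 1, hi⟩) :
    tlAct q (tlGen i hi) (Finsupp.single a 1) = (q : ℂ) • Finsupp.single a 1 := by
  rw [tlAct_single, cap_eq_self h, capCoeff, if_pos h]

theorem tlAct_single_of_through (q : ℝ) {a : HalfDiagram n} {i : ℕ} {hi : i + 1 < n}
    (h : a.partner ⟨i, by omega⟩ = ⟨i, by omega⟩) (h' : a.partner ⟨i + 1, hi⟩ = ⟨i + 1, hi⟩) :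
    tlAct q (tlGen i hi) (Finsupp.single a 1) = 0 := by
  rw [tlAct_single, capCoeff, if_neg (by simp [h]), if_pos ⟨h, h'⟩, zero_smul]

theorem halfSpace_induction {P : HalfSpace n → Prop} (h1 : ∀ a, P (Finsupp.single a 1))
    (h2 : ∀ v w, P v → P w → P (v + w)) (h3 : ∀ (c : ℂ) v, P v → P (c • v)) (v : HalfSpace n) :
    P v := by
  induction v using Finsupp.induction_linear with
  -- Zero is a multiple of the basis element with only through-strings.
  | zero => simpa using h3 0 (Finsupp.single ⟨id, by simp, by grind, by grind⟩ 1) (h1 _)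
  | add v w hv hw => exact h2 v w hv hw
  | single a c => simpa using h3 c _ (h1 a)

theorem tlAct_tlAct_self (q : ℝ) (i : ℕ) (hi : i + 1 < n) (v : HalfSpace n) :
    tlAct q (tlGen i hi) (tlAct q (tlGen i hi) v) = (q : ℂ) • tlAct q (tlGen i hi) v := by
  induction v using halfSpace_induction with
  | h1 a =>
    rw [tlAct_single, map_smul, tlAct_single_of_arch q (cap_partner a i hi), smul_comm]
  | h2 v w hv hw => simp only [map_add, smul_add, hv, hw]
  | h3 c v hv => rw [map_smul, map_smul, hv, smul_comm]

theorem tlAct_comm (q : ℝ) {i j : ℕ} (hi : i + 1 < n) (hj : j + 1 < n)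
    (hij : i + 1 < j ∨ j + 1 < i) (v : HalfSpace n) :
    tlAct q (tlGen i hi) (tlAct q (tlGen j hj) v) =
      tlAct q (tlGen j hj) (tlAct q (tlGen i hi) v) := by
  induction v using halfSpace_induction with
  | h1 a =>
    simp only [tlAct_single, map_smul, smul_smul]
    congr 1
    · simp only [capCoeff_eq]
      refine capCoeffFun_capFun_comm _ ?_ ?_ ?_ ?_ ?_ ?_ _ a.partner_partner <;>
        simp only [ne_eq, Fin.mk.injEq] <;> omega
    · congr 1
      refine HalfDiagram.ext (capFun_capFun_comm ?_ ?_ ?_ ?_ ?_ ?_ _ a.partner_partner) <;>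
        simp only [ne_eq, Fin.mk.injEq] <;> omega
  | h2 v w hv hw => simp only [map_add, hv, hw]
  | h3 c v hv => simp only [map_smul, hv]

theorem tlAct_tlAct_of_arch (q : ℝ) {i j : ℕ} {hi : i + 1 < n} {hj : j + 1 < n}
    (hij : j = i + 1 ∨ i = j + 1) {a : HalfDiagram n}
    (h : a.partner ⟨i, by omega⟩ = ⟨i + 1, hi⟩) :
    tlAct q (tlGen i hi) (tlAct q (tlGen j hj) (Finsupp.single a 1)) = Finsupp.single a 1 := by
  have h0 := a.partner_partner
  have e1 := h0 ⟨i, by omega⟩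
  simp only [tlAct_single, map_smul, smul_smul]
  have hc : (a.cap j hj).cap i hi = a := by
    refine HalfDiagram.ext ?_
    simp only [HalfDiagram.cap]
    rcases hij with rfl | rfl
    · refine capFun_capFun_of_arch ?_ ?_ ?_ _ h0 h <;> simp only [ne_eq, Fin.mk.injEq] <;> omega
    · rw [capFun_comm, capFun_comm (⟨j, by omega⟩ : Fin n)]
      refine capFun_capFun_of_arch ?_ ?_ ?_ _ h0 (by rw [← h, e1]) <;>
        simp only [ne_eq, Fin.mk.injEq] <;> omega
  rw [hc]
  have h1 : capCoeff q a j hj = 1 := by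
    simp only [capCoeff]
    rcases hij with rfl | rfl
    · rw [if_neg (by grind), if_neg (by grind)]
    · rw [if_neg (by grind), if_neg (by grind)]
  have h2 : capCoeff q (a.cap j hj) i hi = 1 := by
    have hc' : (a.cap j hj).partner = capFun ⟨j, by omega⟩ ⟨j + 1, hj⟩ a.partner := rfl
    simp only [capCoeff, hc']
    rcases hij with rfl | rfl
    · rw [if_neg (by grind [capFun]), if_neg (by grind [capFun])]
    · rw [if_neg (by grind [capFun]), if_neg (by grind [capFun])]
  rw [h1, h2, one_mul, one_smul]

theorem tlAct_tlAct_tlAct (q : ℝ) {i j : ℕ} (hi : i + 1 < n) (hj : j + 1 < n)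
    (hij : j = i + 1 ∨ i = j + 1) (v : HalfSpace n) :
    tlAct q (tlGen i hi) (tlAct q (tlGen j hj) (tlAct q (tlGen i hi) v)) =
      tlAct q (tlGen i hi) v := by
  induction v using halfSpace_induction with
  | h1 a =>
    rw [tlAct_single, map_smul, map_smul, tlAct_tlAct_of_arch q hij (cap_partner a i hi)]
  | h2 v w hv hw => simp only [map_add, hv, hw]
  | h3 c v hv => simp only [map_smul, hv]

end relations

/-- The point `i + 1` is not joined to `i + 2`, and at most one of these points carries a
through-string. -/
def CapNondegenerate {n : ℕ} (b : HalfDiagram n) (i : ℕ) (hi : i + 1 < n) : Prop :=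
  b.partner ⟨i, by omega⟩ ≠ ⟨i + 1, hi⟩ ∧
    ¬ (b.partner ⟨i, by omega⟩ = ⟨i, by omega⟩ ∧ b.partner ⟨i + 1, hi⟩ = ⟨i + 1, hi⟩)

/-! ### Self-adjointness of the generators -/

section form

variable {n : ℕ}

theorem glueGraph_comm (a b : HalfDiagram n) : glueGraph a b = glueGraph b a := by
  simp only [glueGraph, or_comm]

theorem halfFormBasis_comm (q : ℝ) (a b : HalfDiagram n) :
    halfFormBasis q a b = halfFormBasis q b a := by
  have h1 : GlueVanishes a b ↔ GlueVanishes b a := by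
    simp only [GlueVanishes, glueGraph_comm a b, or_comm]
  have h2 : glueLoops a b = glueLoops b a := by
    unfold glueLoops
    rw [glueGraph_comm a b]
    simp only [and_comm]
  unfold halfFormBasis
  by_cases h : GlueVanishes a b
  · rw [if_pos h, if_pos (h1.1 h)]
  · rw [if_neg h, if_neg (mt h1.2 h), h2]

theorem glue_reachable_left (a b : HalfDiagram n) (k : Fin n) :
    (glueGraph a b).Reachable k (a.partner k) := reachable_fromRel (Or.inl rfl)

theorem glue_reachable_right (a b : HalfDiagram n) (k : Fin n) :
    (glueGraph a b).Reachable k (b.partner k) := reachable_fromRel (Or.inr rfl)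

/-- The map that moves `u` and `v` to a point joined to one of them by an arch of `b`. -/
def capFold (b : HalfDiagram n) (u v k : Fin n) : Fin n :=
  if k = u ∨ k = v then capRep b u v else k

variable {a b : HalfDiagram n} {i : ℕ} {hi : i + 1 < n}

theorem capFold_ne (hb : CapNondegenerate b i hi) (k : Fin n) :
    capFold b ⟨i, by omega⟩ ⟨i + 1, hi⟩ k ≠ ⟨i, by omega⟩ ∧
      capFold b ⟨i, by omega⟩ ⟨i + 1, hi⟩ k ≠ ⟨i + 1, hi⟩ := by
  obtain ⟨h1, h2⟩ := hb
  have e1 := b.partner_partner ⟨i, by omega⟩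
  have e2 := b.partner_partner ⟨i + 1, hi⟩
  unfold capFold capRep
  grind

theorem glue_reachable_capFold (ha : a.partner ⟨i, by omega⟩ = ⟨i + 1, hi⟩) (k : Fin n) :
    (glueGraph a b).Reachable k (capFold b ⟨i, by omega⟩ ⟨i + 1, hi⟩ k) := by
  have h1 := glue_reachable_left a b ⟨i, by omega⟩
  have h2 := glue_reachable_right a b
  rw [ha] at h1
  generalize (⟨i, by omega⟩ : Fin n) = u at *
  generalize (⟨i + 1, hi⟩ : Fin n) = v at *
  unfold capFold capRep
  split_ifs with h3 h4
  · rcases h3 with rfl | rfl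
    · exact h1.trans (h2 _)
    · exact h2 _
  · rcases h3 with rfl | rfl
    · exact h2 _
    · exact h1.symm.trans (h2 _)
  · exact SimpleGraph.Reachable.refl _

/-- A new arch of `b.cap` between former partners replaces a path through the arch of `a` at i. The
second claim says that this arch now forms a component of its own. -/
theorem reachable_of_reachable_cap (ha : a.partner ⟨i, by omega⟩ = ⟨i + 1, hi⟩) {s t : Fin n}
    (hst : (glueGraph a (b.cap i hi)).Reachable s t) :
    (glueGraph a b).Reachable s t ∧ ((s = ⟨i, by omega⟩ ∨ s = ⟨i + 1, hi⟩) ↔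
      (t = ⟨i, by omega⟩ ∨ t = ⟨i + 1, hi⟩)) := by
  have huv : (⟨i, by omega⟩ : Fin n) ≠ ⟨i + 1, hi⟩ := by simp
  have hc : (b.cap i hi).partner = capFun ⟨i, by omega⟩ ⟨i + 1, hi⟩ b.partner := rfl
  have h0 := b.partner_partner
  have h0' := a.partner_partner
  have h1 := glue_reachable_left a b
  have h2 := glue_reachable_right a b
  refine rel_of_reachable_fromRel (S := fun s t => (glueGraph a b).Reachable s t ∧
    ((s = ⟨i, by omega⟩ ∨ s = ⟨i + 1, hi⟩) ↔ (t = ⟨i, by omega⟩ ∨ t = ⟨i + 1, hi⟩)))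
    ⟨fun _ => ⟨SimpleGraph.Reachable.refl _, Iff.rfl⟩, fun h => ⟨h.1.symm, h.2.symm⟩,
      fun h h' => ⟨h.1.trans h'.1, h.2.trans h'.2⟩⟩ ?_ hst
  rw [hc]
  generalize (⟨i, by omega⟩ : Fin n) = u at *
  generalize (⟨i + 1, hi⟩ : Fin n) = v at *
  have h3 : (glueGraph a b).Reachable u v := by
    have := h1 u
    rwa [ha] at this
  have h4 := h0' u
  rintro s t (rfl | rfl)
  · exact ⟨h1 s, by grind⟩
  · refine ⟨?_, by grind [capFun]⟩
    by_cases hsu : s = u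
    · simpa [capFun, hsu] using h3
    by_cases hsv : s = v
    · simpa [capFun, hsv, huv.symm] using h3.symm
    by_cases hsu' : s = b.partner u
    · by_cases hv : b.partner v = v
      · rw [show capFun u v b.partner s = s by grind [capFun]]
      · rw [show capFun u v b.partner s = b.partner v by grind [capFun], hsu']
        exact (h2 u).symm.trans (h3.trans (h2 v))
    by_cases hsv' : s = b.partner v
    · by_cases hu : b.partner u = u
      · rw [show capFun u v b.partner s = s by grind [capFun]]
      · rw [show capFun u v b.partner s = b.partner u by grind [capFun], hsv']
        exact (h2 v).symm.trans (h3.symm.trans (h2 u))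
    rw [show capFun u v b.partner s = b.partner s by grind [capFun]]
    exact h2 s

theorem reachable_cap_of_reachable (ha : a.partner ⟨i, by omega⟩ = ⟨i + 1, hi⟩)
    (hb : CapNondegenerate b i hi) {s t : Fin n} (hst : (glueGraph a b).Reachable s t) :
    (glueGraph a (b.cap i hi)).Reachable (capFold b ⟨i, by omega⟩ ⟨i + 1, hi⟩ s)
      (capFold b ⟨i, by omega⟩ ⟨i + 1, hi⟩ t) := by
  have huv : (⟨i, by omega⟩ : Fin n) ≠ ⟨i + 1, hi⟩ := by simp
  have hc : (b.cap i hi).partner = capFun ⟨i, by omega⟩ ⟨i + 1, hi⟩ b.partner := rfl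
  have h0 := b.partner_partner
  have h0' := a.partner_partner
  have h1 := glue_reachable_left a (b.cap i hi)
  have h2 := glue_reachable_right a (b.cap i hi)
  rw [hc] at h2
  obtain ⟨hb1, hb2⟩ := hb
  refine rel_of_reachable_fromRel (S := fun s t => (glueGraph a (b.cap i hi)).Reachable
    (capFold b ⟨i, by omega⟩ ⟨i + 1, hi⟩ s) (capFold b ⟨i, by omega⟩ ⟨i + 1, hi⟩ t))
    ⟨fun _ => SimpleGraph.Reachable.refl _, fun h => h.symm, fun h h' => h.trans h'⟩ ?_ hst
  generalize (⟨i, by omega⟩ : Fin n) = u at *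
  generalize (⟨i + 1, hi⟩ : Fin n) = v at *
  have e1 := h0' u
  have e2 := h0 u
  have e3 := h0 v
  have hrep : capRep b u v ≠ u ∧ capRep b u v ≠ v := by
    unfold capRep
    grind
  have hrep' : b.partner (capRep b u v) = u ∨ b.partner (capRep b u v) = v := by
    unfold capRep
    grind
  rintro s t (rfl | rfl)
  · by_cases hs : s = u ∨ s = v
    · rw [show capFold b u v (a.partner s) = capFold b u v s by unfold capFold; grind]
    · rw [capFold, if_neg hs, capFold, if_neg (by grind)]
      exact h1 s
  · have key : ∀ s, (s = u ∨ s = v) → (glueGraph a (b.cap i hi)).Reachable (capRep b u v)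
        (capFold b u v (b.partner s)) := by
      intro s hs
      by_cases hs' : b.partner s = s
      · rw [hs', capFold, if_pos hs]
      rw [capFold, if_neg (by grind)]
      by_cases hs2 : capRep b u v = b.partner s
      · rw [hs2]
      · have := h2 (capRep b u v)
        rwa [show capFun u v b.partner (capRep b u v) = b.partner s by grind [capFun, capRep]]
          at this
    by_cases hs : s = u ∨ s = v
    · have := key s hs
      rwa [capFold, if_pos hs]
    · by_cases hs' : b.partner s = u ∨ b.partner s = v
      · have := key (b.partner s) hs'
        rw [h0] at this
        rw [capFold.eq_1 b u v (b.partner s), if_pos hs']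
        exact this.symm
      · rw [capFold, if_neg hs, capFold, if_neg hs']
        have := h2 s
        rwa [show capFun u v b.partner s = b.partner s by grind [capFun]] at this

theorem capFold_of_fixed_left (ha : a.partner ⟨i, by omega⟩ = ⟨i + 1, hi⟩) {k : Fin n}
    (hk : a.partner k = k) : capFold b ⟨i, by omega⟩ ⟨i + 1, hi⟩ k = k := by
  have huv : (⟨i, by omega⟩ : Fin n) ≠ ⟨i + 1, hi⟩ := by simp
  have e1 := a.partner_partner ⟨i, by omega⟩
  unfold capFold
  grind

theorem cap_partner_capFold (hb : CapNondegenerate b i hi) {k : Fin n}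
    (hk : b.partner k = k) : (b.cap i hi).partner (capFold b ⟨i, by omega⟩ ⟨i + 1, hi⟩ k) =
      capFold b ⟨i, by omega⟩ ⟨i + 1, hi⟩ k := by
  have huv : (⟨i, by omega⟩ : Fin n) ≠ ⟨i + 1, hi⟩ := by simp
  have hc : (b.cap i hi).partner = capFun ⟨i, by omega⟩ ⟨i + 1, hi⟩ b.partner := rfl
  have e1 := b.partner_partner ⟨i, by omega⟩
  have e2 := b.partner_partner ⟨i + 1, hi⟩
  obtain ⟨hb1, hb2⟩ := hb
  rw [hc]
  generalize (⟨i, by omega⟩ : Fin n) = u at *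
  generalize (⟨i + 1, hi⟩ : Fin n) = v at *
  unfold capFold capRep
  grind [capFun]

theorem capFold_inj_of_fixed (hb : CapNondegenerate b i hi) {k l : Fin n}
    (hk : b.partner k = k) (hl : b.partner l = l)
    (hkl : capFold b ⟨i, by omega⟩ ⟨i + 1, hi⟩ k = capFold b ⟨i, by omega⟩ ⟨i + 1, hi⟩ l) :
    k = l := by
  have e1 := b.partner_partner ⟨i, by omega⟩
  have e2 := b.partner_partner ⟨i + 1, hi⟩
  obtain ⟨hb1, hb2⟩ := hb
  unfold capFold capRep at hkl
  grind

/-- Through-strings of `b.cap i hi` come from through-strings of `b`. -/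
theorem exists_fixed_of_cap_fixed (hb : CapNondegenerate b i hi) {k : Fin n} (hk : (b.cap i hi).partner k = k) :
    ∃ l, b.partner l = l ∧ capFold b ⟨i, by omega⟩ ⟨i + 1, hi⟩ l = k := by
  have huv : (⟨i, by omega⟩ : Fin n) ≠ ⟨i + 1, hi⟩ := by simp
  have hc : (b.cap i hi).partner = capFun ⟨i, by omega⟩ ⟨i + 1, hi⟩ b.partner := rfl
  have h0 := b.partner_partner
  obtain ⟨hb1, hb2⟩ := hb
  rw [hc] at hk
  generalize (⟨i, by omega⟩ : Fin n) = u at *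
  generalize (⟨i + 1, hi⟩ : Fin n) = v at *
  have e1 := h0 u
  have e2 := h0 v
  by_cases hbk : b.partner k = k
  · exact ⟨k, hbk, by unfold capFold; grind [capFun]⟩
  by_cases hu : b.partner u = u
  · exact ⟨u, hu, by unfold capFold capRep; grind [capFun]⟩
  · exact ⟨v, by grind [capFun], by unfold capFold capRep; grind [capFun]⟩

theorem glueVanishes_cap_iff (ha : a.partner ⟨i, by omega⟩ = ⟨i + 1, hi⟩)
    (hb : CapNondegenerate b i hi) : GlueVanishes a (b.cap i hi) ↔ GlueVanishes a b := by
  constructor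
  · rintro ⟨s, t, hst, hr, ⟨hs, ht⟩ | ⟨hs, ht⟩⟩
    · exact ⟨s, t, hst, (reachable_of_reachable_cap ha hr).1, Or.inl ⟨hs, ht⟩⟩
    · obtain ⟨s', hs', h1⟩ := exists_fixed_of_cap_fixed hb hs
      obtain ⟨t', ht', h2⟩ := exists_fixed_of_cap_fixed hb ht
      refine ⟨s', t', fun h => hst (by rw [← h1, h, h2]), ?_, Or.inr ⟨hs', ht'⟩⟩
      have h3 := glue_reachable_capFold (b := b) ha s'
      have h4 := glue_reachable_capFold (b := b) ha t'
      rw [h1] at h3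
      rw [h2] at h4
      exact h3.trans ((reachable_of_reachable_cap ha hr).1.trans h4.symm)
  · rintro ⟨s, t, hst, hr, ⟨hs, ht⟩ | ⟨hs, ht⟩⟩
    · refine ⟨s, t, hst, ?_, Or.inl ⟨hs, ht⟩⟩
      have := reachable_cap_of_reachable ha hb hr
      rwa [capFold_of_fixed_left ha hs, capFold_of_fixed_left ha ht] at this
    · exact ⟨_, _, fun h => hst (capFold_inj_of_fixed hb hs ht h),
        reachable_cap_of_reachable ha hb hr,
        Or.inr ⟨cap_partner_capFold hb hs, cap_partner_capFold hb ht⟩⟩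

/-- The arch of `a` splits off as a new loop; the old components survive, shortened, under
`capFold`. -/
theorem glueLoops_cap (ha : a.partner ⟨i, by omega⟩ = ⟨i + 1, hi⟩)
    (hb : CapNondegenerate b i hi) : glueLoops a (b.cap i hi) = glueLoops a b + 1 := by
  have hR := fun s t => reachable_of_reachable_cap (b := b) ha (s := s) (t := t)
  have hR' := fun s t => reachable_cap_of_reachable ha hb (s := s) (t := t)
  have hF := glue_reachable_capFold (b := b) ha
  have hne := capFold_ne hb
  set L₁ : Set (glueGraph a b).ConnectedComponent :=
    {C | ∀ k ∈ C.supp, a.partner k ≠ k ∧ b.partner k ≠ k} with hL₁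
  set L₂ : Set (glueGraph a (b.cap i hi)).ConnectedComponent :=
    {C | ∀ k ∈ C.supp, a.partner k ≠ k ∧ (b.cap i hi).partner k ≠ k} with hL₂
  let φ : (glueGraph a b).ConnectedComponent → (glueGraph a (b.cap i hi)).ConnectedComponent :=
    SimpleGraph.ConnectedComponent.lift
      (fun k => (glueGraph a (b.cap i hi)).connectedComponentMk
        (capFold b ⟨i, by omega⟩ ⟨i + 1, hi⟩ k))
      (fun s t p _ => SimpleGraph.ConnectedComponent.sound (hR' s t p.reachable))
  have hφ : Function.Injective φ := by
    intro C D hCD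
    induction C using SimpleGraph.ConnectedComponent.ind with | _ s =>
    induction D using SimpleGraph.ConnectedComponent.ind with | _ t =>
    have h1 := (hR _ _ (SimpleGraph.ConnectedComponent.exact hCD)).1
    exact SimpleGraph.ConnectedComponent.sound ((hF s).trans (h1.trans (hF t).symm))
  set C₀ := (glueGraph a (b.cap i hi)).connectedComponentMk ⟨i, by omega⟩ with hC₀
  -- `capFold` avoids the two points that make up `C₀`.
  have hC₀φ : C₀ ∉ φ '' L₁ := by
    rintro ⟨C, _, hC⟩
    induction C using SimpleGraph.ConnectedComponent.ind with | _ s =>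
    have h1 := (hR _ _ (SimpleGraph.ConnectedComponent.exact hC)).2.2 (Or.inl rfl)
    exact h1.elim (hne s).1 (hne s).2
  have hL : L₂ = insert C₀ (φ '' L₁) := by
    ext C
    induction C using SimpleGraph.ConnectedComponent.ind with | _ s =>
    constructor
    · intro hC
      by_cases hs : s = ⟨i, by omega⟩ ∨ s = ⟨i + 1, hi⟩
      · left
        rcases hs with rfl | rfl
        · rfl
        · refine SimpleGraph.ConnectedComponent.sound ?_
          have := glue_reachable_left a (b.cap i hi) ⟨i, by omega⟩
          rw [ha] at this
          exact this.symm
      · have hfs : capFold b ⟨i, by omega⟩ ⟨i + 1, hi⟩ s = s := if_neg hs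
        refine Or.inr ⟨(glueGraph a b).connectedComponentMk s, ?_, ?_⟩
        · intro k hk
          have h1 := hR' _ _ (SimpleGraph.ConnectedComponent.exact hk)
          rw [hfs] at h1
          have h2 := hC _ (SimpleGraph.ConnectedComponent.sound h1)
          refine ⟨fun h => h2.1 ?_, fun h => h2.2 (cap_partner_capFold hb h)⟩
          rw [capFold_of_fixed_left ha h, h]
        · exact congrArg _ hfs
    · rintro (hC | ⟨C, hC, hCs⟩)
      · intro k hk
        rw [hC] at hk
        have h1 := (hR _ _ (SimpleGraph.ConnectedComponent.exact hk)).2.2 (Or.inl rfl)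
        have e1 := a.partner_partner ⟨i, by omega⟩
        have e2 := (b.cap i hi).partner_partner ⟨i, by omega⟩
        have e3 := cap_partner b i hi
        have huv : (⟨i, by omega⟩ : Fin n) ≠ ⟨i + 1, hi⟩ := by simp
        rcases h1 with rfl | rfl <;> grind
      · induction C using SimpleGraph.ConnectedComponent.ind with | _ t =>
        have hts := (hR _ _ (SimpleGraph.ConnectedComponent.exact hCs)).1
        have hmem : ∀ k l, (glueGraph a (b.cap i hi)).Reachable k s →
            (glueGraph a b).Reachable l k → a.partner l ≠ l ∧ b.partner l ≠ l := by
          intro k l hk hl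
          exact hC l (SimpleGraph.ConnectedComponent.sound (hl.trans
            ((hR _ _ hk).1.trans (hts.symm.trans (hF t).symm))))
        intro k hk
        have hk' := SimpleGraph.ConnectedComponent.exact hk
        refine ⟨(hmem k k hk' (SimpleGraph.Reachable.refl _)).1, fun h => ?_⟩
        obtain ⟨l, hl, hlk⟩ := exists_fixed_of_cap_fixed hb h
        exact (hmem k l hk' (hlk ▸ hF l)).2 hl
  have h1 : glueLoops a b = L₁.ncard := rfl
  have h2 : glueLoops a (b.cap i hi) = L₂.ncard := rfl
  rw [h1, h2, hL, Set.ncard_insert_of_notMem hC₀φ (Set.toFinite _), Set.ncard_image_of_injective _ hφ]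

/-- In terms of the form, ⟨ξ_a, e_i ξ_b⟩ = q⟨ξ_a, ξ_b⟩ when e_i ξ_a = q ξ_a. The factor q is the
scalar of `e_i` if `b` has the arch too, and otherwise the extra loop; if `b` has two
through-strings there, both sides vanish. -/
theorem capCoeff_mul_halfFormBasis (q : ℝ) (ha : a.partner ⟨i, by omega⟩ = ⟨i + 1, hi⟩) :
    capCoeff q b i hi * (halfFormBasis q a (b.cap i hi) : ℂ) = q * (halfFormBasis q a b : ℂ) := by
  have huv : (⟨i, by omega⟩ : Fin n) ≠ ⟨i + 1, hi⟩ := by simp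
  unfold capCoeff
  split_ifs with h1 h2
  · rw [cap_eq_self h1]
  · have h3 : GlueVanishes a b := by
      refine ⟨_, _, huv, ?_, Or.inr h2⟩
      have := glue_reachable_left a b ⟨i, by omega⟩
      rwa [ha] at this
    simp [halfFormBasis, h3]
  · have hb : CapNondegenerate b i hi := ⟨h1, h2⟩
    have h3 := glueVanishes_cap_iff ha hb
    unfold halfFormBasis
    by_cases h : GlueVanishes a b
    · rw [if_pos h, if_pos (h3.2 h)]
      simp
    · rw [if_neg h, if_neg (mt h3.1 h), glueLoops_cap ha hb]
      push_cast
      ring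

/-- Both q⟨e_i ξ_a, ξ_b⟩ and q⟨ξ_a, e_i ξ_b⟩ equal ⟨e_i ξ_a, e_i ξ_b⟩, because e_i ξ_a and e_i ξ_b
are multiples of diagrams with the arch at i. -/
theorem capCoeff_mul_halfFormBasis_comm {q : ℝ} (hq : q ≠ 0) (a b : HalfDiagram n) (i : ℕ)
    (hi : i + 1 < n) :
    capCoeff q a i hi * (halfFormBasis q (a.cap i hi) b : ℂ) =
      capCoeff q b i hi * (halfFormBasis q a (b.cap i hi) : ℂ) := by
  have h1 := capCoeff_mul_halfFormBasis (b := b) q (cap_partner a i hi)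
  have h2 := capCoeff_mul_halfFormBasis (b := a) q (cap_partner b i hi)
  rw [halfFormBasis_comm, halfFormBasis_comm q _ a] at h2
  have hq' : (q : ℂ) ≠ 0 := by exact_mod_cast hq
  apply mul_left_cancel₀ hq'
  linear_combination (capCoeff q b i hi) * h2 - (capCoeff q a i hi) * h1

theorem halfForm_add_left (q : ℝ) (u v w : HalfSpace n) :
    halfForm q (u + v) w = halfForm q u w + halfForm q v w := by
  unfold halfForm
  rw [Finsupp.sum_add_index'] <;> simp [Finsupp.sum, add_mul, Finset.sum_add_distrib]

theorem halfForm_smul_left (q : ℝ) (c : ℂ) (v w : HalfSpace n) :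
    halfForm q (c • v) w = c * halfForm q v w := by
  unfold halfForm
  rw [Finsupp.sum_smul_index' (by simp)]
  simp only [Finsupp.sum, Finset.mul_sum, smul_eq_mul, mul_assoc]

theorem halfForm_conj (q : ℝ) (v w : HalfSpace n) :
    halfForm q w v = starRingEnd ℂ (halfForm q v w) := by
  simp only [halfForm, Finsupp.sum, map_sum, map_mul, Complex.conj_ofReal, RingHomCompTriple.comp_apply,
    RingHom.id_apply]
  rw [Finset.sum_comm]
  refine Finset.sum_congr rfl fun a _ => Finset.sum_congr rfl fun b _ => ?_
  rw [halfFormBasis_comm]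
  ring

theorem halfForm_add_right (q : ℝ) (u v w : HalfSpace n) :
    halfForm q u (v + w) = halfForm q u v + halfForm q u w := by
  rw [halfForm_conj, halfForm_add_left, map_add, ← halfForm_conj, ← halfForm_conj]

theorem halfForm_smul_right (q : ℝ) (c : ℂ) (v w : HalfSpace n) :
    halfForm q v (c • w) = starRingEnd ℂ c * halfForm q v w := by
  rw [halfForm_conj, halfForm_smul_left, map_mul, ← halfForm_conj]

theorem halfForm_single (q : ℝ) (a b : HalfDiagram n) :
    halfForm q (Finsupp.single a 1) (Finsupp.single b 1) = halfFormBasis q a b := by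
  simp [halfForm]

theorem conj_capCoeff (q : ℝ) (a : HalfDiagram n) (i : ℕ) (hi : i + 1 < n) :
    starRingEnd ℂ (capCoeff q a i hi) = capCoeff q a i hi := by
  unfold capCoeff
  split_ifs <;> simp

/-- The generators are self-adjoint. -/
theorem halfForm_tlAct {q : ℝ} (hq : q ≠ 0) (i : ℕ) (hi : i + 1 < n) (v w : HalfSpace n) :
    halfForm q (tlAct q (tlGen i hi) v) w = halfForm q v (tlAct q (tlGen i hi) w) := by
  induction v using halfSpace_induction with
  | h1 a =>
    induction w using halfSpace_induction with
    | h1 b =>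
      simp only [tlAct_single, halfForm_smul_left, halfForm_smul_right, halfForm_single,
        conj_capCoeff]
      exact capCoeff_mul_halfFormBasis_comm hq a b i hi
    | h2 v w hv hw => simp only [map_add, halfForm_add_right, hv, hw]
    | h3 c v hv => simp only [map_smul, halfForm_smul_right, hv]
  | h2 v w hv hw => simp only [map_add, halfForm_add_left, hv, hw]
  | h3 c v hv => simp only [map_smul, halfForm_smul_left, hv]

end form

/-! ### The vectors ξ', the action of the generators on them, and orthogonality -/

section whiteBox

variable {n : ℕ}

theorem exists_isWhiteBox (q : ℝ) (a : HalfDiagram n) : ∃ v, IsWhiteBox q a v := by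
  induction h : a.closingSum using Nat.strong_induction_on generalizing a with
  | _ m ih =>
    by_cases ha : a.IsMinimal
    · exact ⟨_, IsWhiteBox.minimal a ha⟩
    · obtain ⟨i, hi, c, hc⟩ := HalfDiagram.exists_isBoxAddition_of_not_isMinimal ha
      obtain ⟨v, hv⟩ := ih _ (h ▸ hc.closingSum_lt) c rfl
      exact ⟨_, IsWhiteBox.box c a v i hi hv hc⟩

theorem isWhiteBox_unique {q : ℝ} {a : HalfDiagram n} {v w : HalfSpace n} (hv : IsWhiteBox q a v)
    (hw : IsWhiteBox q a w) : v = w := by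
  induction h : a.closingSum using Nat.strong_induction_on generalizing a v w with
  | _ m ih =>
    subst h
    cases hv with
    | minimal _ ha =>
      cases hw with
      | minimal _ _ => rfl
      | box c _ w j hj hw hc => exact absurd hc (HalfDiagram.not_isBoxAddition_of_isMinimal ha)
    | box b _ v i hi hv hb =>
      cases hw with
      | minimal _ ha => exact absurd hb (HalfDiagram.not_isBoxAddition_of_isMinimal ha)
      | box c _ w j hj hw hc =>
        by_cases hij : i = j
        · subst hij
          obtain rfl := hb.unique_left hc
          rw [ih _ hb.closingSum_lt hv hw rfl]
        · obtain ⟨hij', d, hdb, hdc⟩ := hb.diamond hc hij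
          -- By induction `v` and `w` both arise from `u` by one box; the other box then has the
          -- same μ on either route, as the heights involved are unchanged.
          obtain ⟨u, hu⟩ := exists_isWhiteBox q d
          rw [ih _ hb.closingSum_lt hv (IsWhiteBox.box d b u j hj hu hdb) rfl,
            ih _ hc.closingSum_lt hw (IsWhiteBox.box d c u i hi hu hdc) rfl,
            hdb.height_eq (m := i + 1) (by omega), hdc.height_eq (m := j + 1) (by omega)]
          simp only [map_sub, map_smul, smul_sub]
          rw [tlAct_comm q hi hj hij', smul_comm (chebMu q (d.height (j + 1) + 1) : ℂ)]
          abel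

/-- The vector `ξ'_a`. -/
noncomputable def whiteBoxVector (q : ℝ) (a : HalfDiagram n) : HalfSpace n :=
  (exists_isWhiteBox q a).choose

theorem isWhiteBox_whiteBoxVector (q : ℝ) (a : HalfDiagram n) :
    IsWhiteBox q a (whiteBoxVector q a) := (exists_isWhiteBox q a).choose_spec

theorem whiteBoxVector_of_isMinimal (q : ℝ) {a : HalfDiagram n} (ha : a.IsMinimal) :
    whiteBoxVector q a = Finsupp.single a 1 :=
  isWhiteBox_unique (isWhiteBox_whiteBoxVector q a) (IsWhiteBox.minimal a ha)

theorem whiteBoxVector_of_isBoxAddition (q : ℝ) {i : ℕ} {hi : i + 1 < n} {a b : HalfDiagram n}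
    (h : HalfDiagram.IsBoxAddition i hi a b) :
    whiteBoxVector q b = tlAct q (tlGen i hi) (whiteBoxVector q a) -
      (chebMu q (a.height (i + 1) + 1) : ℂ) • whiteBoxVector q a :=
  isWhiteBox_unique (isWhiteBox_whiteBoxVector q b)
    (IsWhiteBox.box a b _ i hi (isWhiteBox_whiteBoxVector q a) h)

theorem tlAct_whiteBoxVector_of_hasMinimum (q : ℝ) {i : ℕ} {hi : i + 1 < n} {a b : HalfDiagram n}
    (h : HalfDiagram.IsBoxAddition i hi a b) :
    tlAct q (tlGen i hi) (whiteBoxVector q a) = whiteBoxVector q b +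
      (chebMu q (a.height (i + 1) + 1) : ℂ) • whiteBoxVector q a := by
  rw [whiteBoxVector_of_isBoxAddition q h, sub_add_cancel]

theorem chebDelta_add_one (q : ℝ) (k : ℤ) :
    chebDelta q (k + 1) = q * chebDelta q k - chebDelta q (k - 1) := by
  have := congrArg (Polynomial.eval q) (Polynomial.Chebyshev.S_add_one ℝ k)
  simpa [chebDelta] using this

theorem chebMu_one (q : ℝ) : chebMu q 1 = q⁻¹ := by
  simp [chebMu, chebDelta]

/-- The Chebyshev recursion in the form that makes two adjacent boxes cancel under a generator. -/
theorem chebMu_add_one_mul {q : ℝ} {k : ℤ} (h1 : chebDelta q k ≠ 0)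
    (h2 : chebDelta q (k + 1) ≠ 0) : chebMu q (k + 1) * (q - chebMu q k) = 1 := by
  rw [chebMu, chebMu, add_sub_cancel_right]
  rw [div_mul_eq_mul_div, div_eq_one_iff_eq h2, chebDelta_add_one]
  field_simp

/-- A box added next to a peak of height one turns the peak into a slope, which the generator kills. -/
theorem tlAct_box_of_eigen {q : ℝ} (hq : q ≠ 0) {i j : ℕ} (hi : i + 1 < n) (hj : j + 1 < n)
    (hij : j = i + 1 ∨ i = j + 1) {x : HalfSpace n}
    (hx : tlAct q (tlGen i hi) x = (q : ℂ) • x) :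
    tlAct q (tlGen i hi) (tlAct q (tlGen j hj) x - (chebMu q 1 : ℂ) • x) = 0 := by
  have hq' : (q : ℂ) ≠ 0 := by exact_mod_cast hq
  -- Since e_i x = q x, this relation gives e_i e_j x = x after division by q, while μ_1 = 1/q.
  have h1 := tlAct_tlAct_tlAct q hi hj hij x
  rw [hx, map_smul, map_smul] at h1
  have h2 := smul_right_injective _ hq' h1
  rw [map_sub, h2, map_smul, hx, smul_smul, chebMu_one]
  push_cast
  rw [inv_mul_cancel₀ hq', one_smul, sub_self]

/-- Two boxes added one after the other at adjacent places make a slope, which the generator kills. -/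
theorem tlAct_box_box {q : ℝ} {i j : ℕ} (hi : i + 1 < n) (hj : j + 1 < n)
    (hij : j = i + 1 ∨ i = j + 1) {x : HalfSpace n} (hx : tlAct q (tlGen j hj) x = 0)
    {μ μ' : ℝ} (hμ : μ' * (q - μ) = 1) :
    tlAct q (tlGen i hi) (tlAct q (tlGen j hj) (tlAct q (tlGen i hi) x - (μ : ℂ) • x) -
      (μ' : ℂ) • (tlAct q (tlGen i hi) x - (μ : ℂ) • x)) = 0 := by
  simp only [map_sub, map_smul, hx, smul_zero, sub_zero, tlAct_tlAct_tlAct q hi hj hij,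
    tlAct_tlAct_self]
  have hμ' : (μ' : ℂ) * ((q : ℂ) - μ) = 1 := by exact_mod_cast hμ
  rw [← sub_smul, smul_smul, hμ', one_smul, sub_self]

/-- The generator `e_{i+1}` kills `ξ'_a` if `a` has a slope at `i + 1`, and multiplies it by `q` if `a`
has a peak of height one there. -/
theorem tlAct_whiteBoxVector {q : ℝ} (hq : q ≠ 0) {p : ℕ} (hp : MuDefined q n p) {a : HalfDiagram n}
    (ha : a.numPairs = p) (i : ℕ) (hi : i + 1 < n) :
    ((a.IsOpening ⟨i, by omega⟩ ↔ a.IsOpening ⟨i + 1, hi⟩) →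
      tlAct q (tlGen i hi) (whiteBoxVector q a) = 0) ∧
    (a.IsOpening ⟨i, by omega⟩ → ¬ a.IsOpening ⟨i + 1, hi⟩ → a.height i = 0 →
      tlAct q (tlGen i hi) (whiteBoxVector q a) = (q : ℂ) • whiteBoxVector q a) := by
  induction h : a.closingSum using Nat.strong_induction_on generalizing a i with
  | _ m ih =>
    subst h
    by_cases hmin : a.IsMinimal
    · rw [whiteBoxVector_of_isMinimal q hmin]
      refine ⟨fun hs => ?_, fun h1 h2 _ =>
        tlAct_single_of_arch q (HalfDiagram.partner_eq_of_isOpening rfl h1 h2)⟩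
      by_cases h1 : a.IsOpening ⟨i, by omega⟩
      · obtain ⟨h2, h3⟩ := hmin.through_through h1 (hs.1 h1)
        exact tlAct_single_of_through q h2 h3
      · exact absurd (hs.2 (hmin.not_closing_closing h1)) h1
    obtain ⟨j, hj, c, hc⟩ := HalfDiagram.exists_isBoxAddition_of_not_isMinimal hmin
    have hcp : c.numPairs = p := hc.numPairs_eq.symm.trans ha
    have ihc := fun i hi => ih _ hc.closingSum_lt hcp i hi rfl
    have hcμ := hp c j hj hcp hc.hasMinimum
    have hcj := c.height_succ ⟨j, by omega⟩
    rw [if_neg hc.hasMinimum.1] at hcj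
    simp only at hcj
    by_cases hfar : i + 1 < j ∨ j + 1 < i
    · rw [whiteBoxVector_of_isBoxAddition q hc, hc.height_eq (by omega),
        hc.other _ (by dsimp only; omega) (by dsimp only; omega), hc.other ⟨i + 1, hi⟩ (by dsimp only; omega)
        (by dsimp only; omega), map_sub, map_smul, tlAct_comm q hi hj hfar]
      refine ⟨fun hs => ?_, fun h1 h2 h3 => ?_⟩
      · rw [(ihc i hi).1 hs, map_zero, smul_zero, sub_zero]
      · rw [(ihc i hi).2 h1 h2 h3, map_smul, smul_sub, smul_comm (q : ℂ)]
    by_cases hij : i = j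
    · subst hij
      -- The box has just created a peak at `i`, and it starts at positive height.
      refine ⟨fun hs => absurd (hs.1 hc.opening) hc.closing, fun _ _ h3 => ?_⟩
      rw [hc.height_eq (by omega)] at h3
      have := c.height_nonneg (i + 1)
      omega
    have hij' : j = i + 1 ∨ i = j + 1 := by omega
    -- A slope of `a` next to the box was a peak of `c`, starting at the height of the minimum that
    -- the box fills.
    have hpeak : (a.IsOpening ⟨i, by omega⟩ ↔ a.IsOpening ⟨i + 1, hi⟩) →
        c.IsOpening ⟨i, by omega⟩ ∧ ¬ c.IsOpening ⟨i + 1, hi⟩ ∧ c.height (j + 1) = c.height i := by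
      intro hs
      rcases hij' with rfl | rfl
      · have h1 := (hc.other ⟨i, by omega⟩ (by dsimp only; omega) (by dsimp only; omega)).1 (hs.2 hc.opening)
        have h2 := c.height_succ ⟨i, by omega⟩
        rw [if_pos h1] at h2
        simp only at h2
        exact ⟨h1, hc.hasMinimum.1, by omega⟩
      · exact ⟨hc.hasMinimum.2, fun h => hc.closing (hs.2 ((hc.other ⟨j + 1 + 1, hi⟩ (by dsimp only; omega)
          (by dsimp only; omega)).2 h)), rfl⟩
    refine ⟨fun hs => ?_, fun h1 h2 _ => ?_⟩
    · obtain ⟨h1, h2, h3⟩ := hpeak hs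
      rw [whiteBoxVector_of_isBoxAddition q hc]
      rw [h3] at hcμ ⊢
      rcases (c.height_nonneg i).eq_or_lt with h4 | h4
      · rw [← h4, zero_add]
        exact tlAct_box_of_eigen hq hi hj hij' ((ihc i hi).2 h1 h2 h4.symm)
      · obtain ⟨d, hd⟩ := HalfDiagram.exists_isBoxAddition h1 h2
          (HalfDiagram.exists_of_height_pos h4)
        have hdp : d.numPairs = p := hd.numPairs_eq.symm.trans hcp
        have hdμ := hp d i hi hdp hd.hasMinimum
        have hdi := d.height_succ ⟨i, by omega⟩
        rw [if_neg hd.hasMinimum.1] at hdi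
        simp only at hdi
        rw [← hd.height_eq (m := i) (by omega)] at hdi
        -- Removing that peak as well leaves `d`, which has a slope at `j`; the two boxes carry
        -- consecutive indices of μ.
        have hdh : d.height (i + 1) + 1 = c.height i := by omega
        rw [whiteBoxVector_of_isBoxAddition q hd]
        rw [hdh] at hdμ ⊢
        refine tlAct_box_box hi hj hij' ?_ (chebMu_add_one_mul hdμ hcμ)
        refine (ih _ (hd.closingSum_lt.trans hc.closingSum_lt) hdp j hj rfl).1 ?_
        rcases hij' with rfl | rfl
        · exact iff_of_true hd.hasMinimum.2 ((hd.other ⟨i + 1 + 1, hj⟩ (by dsimp only; omega)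
            (by dsimp only; omega)).1 hc.hasMinimum.2)
        · exact iff_of_false (fun h => hc.hasMinimum.1 ((hd.other ⟨j, by omega⟩ (by dsimp only; omega)
            (by dsimp only; omega)).2 h)) hd.hasMinimum.1
    · rcases hij' with rfl | rfl
      · exact absurd hc.opening h2
      · exact absurd h1 hc.closing

theorem halfForm_sub_right (q : ℝ) (u v w : HalfSpace n) :
    halfForm q u (v - w) = halfForm q u v - halfForm q u w := by
  rw [eq_sub_iff_add_eq, ← halfForm_add_right, sub_add_cancel]

theorem halfForm_zero_left (q : ℝ) (w : HalfSpace n) : halfForm q 0 w = 0 := by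
  simp [halfForm]

theorem halfForm_eq_zero_comm {q : ℝ} {v w : HalfSpace n} (h : halfForm q v w = 0) :
    halfForm q w v = 0 := by
  rw [halfForm_conj, h, map_zero]

/-- Moving a box addition to the other side of the form. -/
theorem halfForm_whiteBoxVector_of_isBoxAddition {q : ℝ} (hq : q ≠ 0) {i : ℕ} {hi : i + 1 < n}
    {b c : HalfDiagram n} (h : HalfDiagram.IsBoxAddition i hi c b) (v : HalfSpace n) :
    halfForm q v (whiteBoxVector q b) =
      halfForm q (tlAct q (tlGen i hi) v) (whiteBoxVector q c) -
        (chebMu q (c.height (i + 1) + 1) : ℂ) * halfForm q v (whiteBoxVector q c) := by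
  rw [whiteBoxVector_of_isBoxAddition q h, halfForm_sub_right, halfForm_smul_right,
    halfForm_tlAct hq, Complex.conj_ofReal]

/-- A minimal half-diagram `m` and another half-diagram `a` differ first at a place where a peak of one
of them meets two opening brackets of the other. -/
theorem HalfDiagram.IsMinimal.exists_slope {m a : HalfDiagram n} (hm : m.IsMinimal) (ham : a ≠ m) :
    ∃ (i : ℕ) (hi : i + 1 < n), a.IsOpening ⟨i, by omega⟩ ∧ m.IsOpening ⟨i, by omega⟩ ∧
      (a.IsOpening ⟨i + 1, hi⟩ ↔ ¬ m.IsOpening ⟨i + 1, hi⟩) := by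
  have h : ∃ k, ¬ (a.IsOpening k ↔ m.IsOpening k) := by
    by_contra! h
    exact ham (HalfDiagram.ext_of_isOpening h)
  obtain ⟨k, hk⟩ := (Set.toFinite {k | ¬ (a.IsOpening k ↔ m.IsOpening k)}).exists_minimal h
  obtain ⟨hk, hmin⟩ := hk
  have hlt : ∀ j : Fin n, j.val < k.val → (a.IsOpening j ↔ m.IsOpening j) := by
    intro j hj
    by_contra hcon
    exact absurd (hmin hcon (Fin.le_def.2 hj.le)) (not_le.2 hj)
  have hh := HalfDiagram.height_congr hlt
  -- One of the two diagrams closes at `k`, and their heights agree up to there.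
  have hpos : 1 ≤ m.height k.val := by
    by_cases h1 : a.IsOpening k
    · exact HalfDiagram.height_pos_of_closing fun h2 => hk (iff_of_true h1 h2)
    · rw [← hh]
      exact HalfDiagram.height_pos_of_closing h1
  obtain ⟨k, hkn⟩ := k
  obtain _ | i := k
  · simp [HalfDiagram.height_zero] at hpos
  -- A closing bracket of `m` at `i` would bring the height down to 0.
  have h3 : m.IsOpening ⟨i, by omega⟩ := by
    by_contra h3
    have h4 := hm _ h3
    have h5 := m.height_succ ⟨i, by omega⟩
    rw [if_neg h3] at h5
    simp only at *
    omega
  refine ⟨i, hkn, (hlt ⟨i, by omega⟩ (by simp)).2 h3, h3, ?_⟩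
  have hk' : ¬ (a.IsOpening ⟨i + 1, hkn⟩ ↔ m.IsOpening ⟨i + 1, hkn⟩) := hk
  tauto

/-- At the place given by `exists_slope`, either `m` has an arch and `a` a slope, or `m` has two
through-strings and `a` a peak. In the latter case the peak has height one or can be removed, for
which the induction is needed. -/
theorem halfForm_whiteBoxVector_of_isMinimal {q : ℝ} (hq : q ≠ 0) {m a : HalfDiagram n}
    (hm : m.IsMinimal) (ha : MuDefined q n a.numPairs) (ham : a ≠ m) :
    halfForm q (whiteBoxVector q m) (whiteBoxVector q a) = 0 := by
  have hq' : (q : ℂ) ≠ 0 := by exact_mod_cast hq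
  induction h : a.closingSum using Nat.strong_induction_on generalizing a with
  | _ s ih =>
    subst h
    obtain ⟨i, hi, h1, h2, h3⟩ := hm.exists_slope ham
    have hadj := halfForm_tlAct hq i hi (whiteBoxVector q m) (whiteBoxVector q a)
    rw [whiteBoxVector_of_isMinimal q hm] at *
    by_cases h4 : m.IsOpening ⟨i + 1, hi⟩
    · obtain ⟨h5, h6⟩ := hm.through_through h2 h4
      have hm0 := tlAct_single_of_through q h5 h6
      have h7 : ¬ a.IsOpening ⟨i + 1, hi⟩ := fun h => h3.1 h h4
      rcases (a.height_nonneg i).eq_or_lt with h8 | h8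
      · rw [hm0, halfForm_zero_left, (tlAct_whiteBoxVector hq ha rfl i hi).2 h1 h7 h8.symm,
          halfForm_smul_right, Complex.conj_ofReal] at hadj
        exact (mul_eq_zero.1 hadj.symm).resolve_left hq'
      · obtain ⟨c, hc⟩ := HalfDiagram.exists_isBoxAddition h1 h7
          (HalfDiagram.exists_of_height_pos h8)
        rw [halfForm_whiteBoxVector_of_isBoxAddition hq hc, hm0, halfForm_zero_left,
          ih _ hc.closingSum_lt (hc.numPairs_eq ▸ ha) (fun h : c = m => hc.hasMinimum.1 (h ▸ h2)) rfl,
          mul_zero, sub_zero]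
    · rw [tlAct_single_of_arch q (HalfDiagram.partner_eq_of_isOpening rfl h2 h4),
        (tlAct_whiteBoxVector hq ha rfl i hi).1 (iff_of_true h1 (h3.2 h4)),
        halfForm_smul_left] at hadj
      refine (mul_eq_zero.1 (hadj.trans ?_)).resolve_left hq'
      exact halfForm_eq_zero_comm (halfForm_zero_left q _)

theorem halfForm_whiteBoxVector {q : ℝ} (hq : q ≠ 0) {a b : HalfDiagram n}
    (ha : MuDefined q n a.numPairs) (hb : MuDefined q n b.numPairs) (hab : a ≠ b) :
    halfForm q (whiteBoxVector q a) (whiteBoxVector q b) = 0 := by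
  induction h : b.closingSum using Nat.strong_induction_on generalizing a b with
  | _ s ih =>
    subst h
    by_cases hmin : b.IsMinimal
    · exact halfForm_eq_zero_comm (halfForm_whiteBoxVector_of_isMinimal hq hmin ha hab)
    obtain ⟨i, hi, c, hc⟩ := HalfDiagram.exists_isBoxAddition_of_not_isMinimal hmin
    have hcμ : MuDefined q n c.numPairs := hc.numPairs_eq ▸ hb
    -- Here the arguments are exchanged, so that the smaller half-diagram becomes the one on which
    -- the induction runs.
    by_cases hac : a = c
    · subst hac
      exact halfForm_eq_zero_comm (ih _ hc.closingSum_lt hb ha (Ne.symm hab) rfl)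
    have ih' := fun a ha hac => ih _ hc.closingSum_lt (a := a) ha hcμ hac rfl
    rw [halfForm_whiteBoxVector_of_isBoxAddition hq hc, ih' a ha hac, mul_zero, sub_zero]
    obtain ⟨hslope, hpeak⟩ := tlAct_whiteBoxVector hq ha rfl i hi
    by_cases h1 : a.IsOpening ⟨i, by omega⟩ <;> by_cases h2 : a.IsOpening ⟨i + 1, hi⟩
    · rw [hslope (iff_of_true h1 h2), halfForm_zero_left]
    · rcases (a.height_nonneg i).eq_or_lt with h3 | h3
      · rw [hpeak h1 h2 h3.symm, halfForm_smul_left, ih' a ha hac, mul_zero]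
      · obtain ⟨d, hd⟩ := HalfDiagram.exists_isBoxAddition h1 h2
          (HalfDiagram.exists_of_height_pos h3)
        have hdc : d ≠ c := by
          rintro rfl
          exact hab (hd.unique_right hc)
        -- With the μ of the box on `d`, e_i ξ'_a = (q - μ) e_i ξ'_d = (q - μ)(ξ'_a + μ ξ'_d).
        rw [whiteBoxVector_of_isBoxAddition q hd, map_sub, map_smul, tlAct_tlAct_self,
          tlAct_whiteBoxVector_of_hasMinimum q hd, ← sub_smul, halfForm_smul_left,
          halfForm_add_left, halfForm_smul_left, ih' a ha hac,
          ih' d (hd.numPairs_eq ▸ ha) hdc, mul_zero, add_zero, mul_zero]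
    · have hd := HalfDiagram.isBoxAddition_cap (a := a) (hi := hi) ⟨h1, h2⟩
      rw [tlAct_whiteBoxVector_of_hasMinimum q hd, halfForm_add_left, halfForm_smul_left,
        ih' a ha hac, ih' _ (hd.numPairs_eq.symm ▸ ha)
          (fun h => hc.hasMinimum.1 (h ▸ hd.opening)), mul_zero, add_zero]
    · rw [hslope (iff_of_false h1 h2), halfForm_zero_left]

end whiteBox

theorem mainTheorem1 (n : ℕ) (q : ℝ) (hq : 0 < q) :
    (∀ a : HalfDiagram n, MuDefined q n a.numPairs → ∃! v : HalfSpace n, IsWhiteBox q a v) ∧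
    (∀ (a b : HalfDiagram n) (v w : HalfSpace n),
      MuDefined q n a.numPairs → MuDefined q n b.numPairs →
      IsWhiteBox q a v → IsWhiteBox q b w → a ≠ b → halfForm q v w = 0) := by
  refine ⟨fun a _ => ?_, fun a b v w ha hb hv hw hab => ?_⟩
  · obtain ⟨v, hv⟩ := exists_isWhiteBox q a
    exact ⟨v, hv, fun w hw => isWhiteBox_unique hw hv⟩
  · rw [isWhiteBox_unique hv (isWhiteBox_whiteBoxVector q a),
      isWhiteBox_unique hw (isWhiteBox_whiteBoxVector q b)]
    exact halfForm_whiteBoxVector hq.ne' ha hb hab
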